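/- Let $n \ge 12$ be an even integer, let $\xi = \exp(2\pi i/n)$, and identify $\mathbb{C}$ with $\mathbb{R}^2 \subset \mathbb{P}^2(\mathbb{R})$, where $(a,b)$ is identified with $(a:b:1)$. Put $P_j = \xi^j$ for $j \in \mathbb{Z}/n$. For $m \ne k$ in $\mathbb{Z}/n$ let $L_{m,k}$ be the line through $P_m$ and $P_k$, and let $L_{m,m}$ be the tangent line to the unit circle at $P_m$. For $0 \le i \le n-1$ let $L_i \in \mathbb{R}[x,y,z]$ be a linear form defining the line $L_{i,\,n/2-2i}$, and let $F_n = \prod_{i=0}^{n-1} L_i$. Let $Z_n \subset \mathbb{P}^2(\mathbb{R})$ be the set of triple points of this configuration (the Füredi–Palásti arrangement), i.e. the points through which exactly three of its lines pass, and let $I = I(Z_n) \subset \mathbb{R}[x,y,z]$ be the homogeneous ideal of $Z_n$. Let $I^{(3)}$ denote the third symbolic power of $I$, i.e. the ideal of all polynomials that vanish to order at least $3$ at every point of $Z_n$; equivalently, $I^{(3)} = \bigcap_{\mathfrak p} \bigl(I^3\,\mathbb{R}[x,y,z]_{\mathfrak p} \cap \mathbb{R}[x,y,z]\bigr)$ over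 the minimal primes $\mathfrak p$ of $I$. Then, for every even $n \ge 12$, the $n$ lines are pairwise distinct, $Z_n$ is finite, and $$F_n \in I^{(3)}, \qquad F_n \notin I^2 .$$ In particular $I^{(3)} \not\subset I^2$, so the sets $Z_n$ form a series of counterexamples, defined over the real numbers, to Huneke's question whether $I^{(3)} \subset I^2$ holds for the ideal $I$ of every finite set of points in the projective plane. For $n = 12$ the set $Z_{12}$ consists of exactly $19$ points, and the configuration is defined over $\mathbb{Q}(\sqrt 3)$: the $12$ lines have equations with coefficients in $\mathbb{Q}(\sqrt 3)$, and every point of $Z_{12}$ has homogeneous coordinates in $\mathbb{Q}(\sqrt 3)$. -/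

import Mathlib

open scoped LinearAlgebra.Projectivization

noncomputable section

/-- The affine cone (without its vertex) over a set `Z` of points of the real projective plane:
all vectors of homogeneous coordinates of points of `Z`. -/
def coneOver (Z : Set (ℙ ℝ (Fin 3 → ℝ))) : Set (Fin 3 → ℝ) :=
  {v | ∃ hv : v ≠ 0, Projectivization.mk ℝ v hv ∈ Z}

/-- The homogeneous ideal `I(Z) ⊆ ℝ[x, y, z]` of a set `Z` of points of the real projective plane:
all polynomials that vanish at all homogeneous coordinates of all points of `Z`.
Since `ℝ` is infinite, this is the ideal generated by the forms that vanish on `Z`. -/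
def idealOfPoints (Z : Set (ℙ ℝ (Fin 3 → ℝ))) : Ideal (MvPolynomial (Fin 3) ℝ) :=
  MvPolynomial.vanishingIdeal ℝ (coneOver Z)

/-- The ideal of the polynomials vanishing to order at least `m` at each point `P` of `Z`, that is,
lying in `I(P) ^ m` for every `P ∈ Z`. -/
def vanishingToOrder (Z : Set (ℙ ℝ (Fin 3 → ℝ))) (m : ℕ) : Ideal (MvPolynomial (Fin 3) ℝ) :=
  ⨅ P ∈ Z, idealOfPoints {P} ^ m

/-- The `m`-th symbolic power of a (radical) ideal `I` of a commutative ring `R`: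
the intersection, over the minimal primes `p` of `I`, of the contractions to `R` of `I ^ m R_p`. -/
def symbolicPower {R : Type*} [CommRing R] (I : Ideal R) (m : ℕ) : Ideal R :=
  ⨅ (p : Ideal R) (hp : p ∈ I.minimalPrimes),
    haveI : p.IsPrime := hp.1.1
    ((I ^ m).map (algebraMap R (Localization.AtPrime p))).comap
      (algebraMap R (Localization.AtPrime p))

namespace FurediPalasti

/-- Homogeneous coordinates `(cos (2πj/n) : sin (2πj/n) : 1)` of the point
`P_j = exp (2πi/n) ^ j` of the unit circle, where `ℂ` is identified with `ℝ²`. -/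
def vertex (n : ℕ) (j : ℤ) : Fin 3 → ℝ :=
  ![Real.cos (2 * Real.pi * j / n), Real.sin (2 * Real.pi * j / n), 1]

/-- The coefficients of a linear form defining the line `L_{m,k}`: the line through `P_m` and `P_k`
(the cross product of the coordinate vectors) if `m` and `k` are different modulo `n`, and the
tangent to the unit circle at `P_m` if `m` and `k` are congruent modulo `n`. -/
def chord (n : ℕ) (m k : ℤ) : Fin 3 → ℝ :=
  if m ≡ k [ZMOD n] then
    ![Real.cos (2 * Real.pi * m / n), Real.sin (2 * Real.pi * m / n), -1]
  else crossProduct (vertex n m) (vertex n k)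

/-- The coefficients of the linear form `L_i`, which defines the line `L_{i, n/2 - 2i}`
(used for even `n` only). -/
def lineCoeff (n i : ℕ) : Fin 3 → ℝ :=
  chord n i (n / 2 - 2 * i)

/-- The linear form `L_i` in `ℝ[x, y, z]`. -/
def linearForm (n i : ℕ) : MvPolynomial (Fin 3) ℝ :=
  ∑ j : Fin 3, MvPolynomial.C (lineCoeff n i j) * MvPolynomial.X j

/-- The zero set of `L_i` in the real projective plane. -/
def line (n i : ℕ) : Set (ℙ ℝ (Fin 3 → ℝ)) :=
  {P | lineCoeff n i ⬝ᵥ P.rep = 0}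

/-- The configuration of the lines `L_0, …, L_{n-1}`. -/
def configuration (n : ℕ) : Set (Set (ℙ ℝ (Fin 3 → ℝ))) :=
  {ℓ | ∃ i < n, ℓ = line n i}

/-- The set `Z_n` of the triple points of the configuration: the points of the projective plane
through which exactly three of its lines pass. -/
def triplePoints (n : ℕ) : Set (ℙ ℝ (Fin 3 → ℝ)) :=
  {P | {ℓ ∈ configuration n | P ∈ ℓ}.ncard = 3}

/-- The product `F_n = L_0 ⋯ L_{n-1}`. -/
def product (n : ℕ) : MvPolynomial (Fin 3) ℝ :=
  ∏ i ∈ Finset.range n, linearForm n i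

/-- The field `ℚ(√3)`, as a subfield of `ℝ`. -/
def qSqrtThree : IntermediateField ℚ ℝ :=
  IntermediateField.adjoin ℚ {√(3 : ℝ)}

end FurediPalasti

end

/-! Parametrise points of the plane as `t₁ + t₂ + t₃` with `tₖ` on the unit circle and `t₁ t₂ t₃ =
1`. Then `x + iy` and `x - iy` become the elementary symmetric functions, and `L_i` pulls back to a
nonzero constant times `∏ₖ (tₖ - ξ^i)` (`ofMvPolynomial_linearForm`). So `L_i` passes through the
point exactly when `ξ^i` is one of the `tₖ`: three distinct lines concur iff their indices sum to
`0` modulo `n`, and the triple points are the images of the `n`-torsion points with distinct `t₁,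
t₂, t₃`. At each of them three factors of `F_n` vanish, whence the order of vanishing.

To see that `F_n ∉ I²`, let `V` be the Vandermonde determinant in the `tₖ`, and compare the
coefficients of `V² f` at the opposite weights `(n, n)` and `(-n, -n)`. They agree on the degree `n`
part of `I²`, but not on `F_n`. For forms `f, g ∈ I` of degrees `a + b = n`, both `V f` and `V g`
vanish at every `n`-torsion point of the torus (`V` takes care of repeated coordinates), so their
coefficients sum to zero over each class of weights modulo `n`. Their supports lie in hexagons of
radii `a + 2` and `b + 2`, with sum only `n + 4`. For `n ≥ 12` the classes that matter therefore
meet the hexagons in at most two weights, `(p, q)` and `(p - n, q - n)`, where the coefficients are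
opposite; one exceptional case at `n = 12` is settled by rotation invariance. In the product the two
signs cancel, so the two coefficients agree term by term (`IsTorsionVanishing.mul_apply_eq`). On the
other hand `F_n` pulls back to a multiple of `∏ₖ (tₖ^n - 1)`, in which the two weights occur with
opposite signs, and `V²` has constant term `-6` (`coeff_vandermonde_sq_mul_ne`). -/

noncomputable section

open MvPolynomial

/-! ### Ideals of points and symbolic powers -/

section Ideals

variable {Z : Set (ℙ ℝ (Fin 3 → ℝ))} {P Q : ℙ ℝ (Fin 3 → ℝ)} {f : MvPolynomial (Fin 3) ℝ}

theorem smul_mem_coneOver {v : Fin 3 → ℝ} (hv : v ∈ coneOver Z) {t : ℝ} (ht : t ≠ 0) :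
    t • v ∈ coneOver Z := by
  obtain ⟨h0, hZ⟩ := hv
  refine ⟨smul_ne_zero ht h0, ?_⟩
  convert hZ using 1
  rw [Projectivization.mk_eq_mk_iff']
  exact ⟨t, rfl⟩

theorem rep_mem_coneOver (hP : P ∈ Z) : P.rep ∈ coneOver Z :=
  ⟨P.rep_nonzero, by rwa [P.mk_rep]⟩

theorem mem_idealOfPoints : f ∈ idealOfPoints Z ↔ ∀ v ∈ coneOver Z, eval v f = 0 := by
  simp only [idealOfPoints, mem_vanishingIdeal_iff, aeval_eq_eval]

theorem idealOfPoints_eq_iInf (Z : Set (ℙ ℝ (Fin 3 → ℝ))) :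
    idealOfPoints Z = ⨅ P ∈ Z, idealOfPoints {P} := by
  ext f
  simp only [Ideal.mem_iInf, mem_idealOfPoints]
  constructor
  · rintro h P hP v ⟨hv, hvP⟩
    exact h v ⟨hv, by rw [Set.mem_singleton_iff.1 hvP]; exact hP⟩
  · rintro h v ⟨hv, hvZ⟩
    exact h _ hvZ v ⟨hv, rfl⟩

theorem mem_coneOver_singleton {v : Fin 3 → ℝ} :
    v ∈ coneOver {P} ↔ ∃ t : ℝ, t ≠ 0 ∧ v = t • P.rep := by
  constructor
  · rintro ⟨hv, hvP⟩
    rw [Set.mem_singleton_iff] at hvP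
    obtain ⟨a, ha⟩ := Projectivization.exists_smul_eq_mk_rep ℝ v hv
    rw [hvP] at ha
    refine ⟨(a : ℝ)⁻¹, inv_ne_zero a.ne_zero, ?_⟩
    rw [← ha, Units.smul_def, smul_smul, inv_mul_cancel₀ a.ne_zero, one_smul]
  · rintro ⟨t, ht, rfl⟩
    exact smul_mem_coneOver (rep_mem_coneOver (Set.mem_singleton P)) ht

/-- The restriction of a polynomial to the line spanned by the vector `v`. -/
def restrictToSpan (v : Fin 3 → ℝ) : MvPolynomial (Fin 3) ℝ →ₐ[ℝ] Polynomial ℝ :=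
  aeval fun i => Polynomial.C (v i) * Polynomial.X

theorem eval_restrictToSpan (v : Fin 3 → ℝ) (f : MvPolynomial (Fin 3) ℝ) (t : ℝ) :
    (restrictToSpan v f).eval t = eval (t • v) f := by
  induction f using MvPolynomial.induction_on with
  | C a => simp [restrictToSpan]
  | add p q hp hq => simp [hp, hq]
  | mul_X p i hp =>
    rw [map_mul, Polynomial.eval_mul, hp]
    simp only [restrictToSpan, aeval_X, Polynomial.eval_mul, Polynomial.eval_C, Polynomial.eval_X,
      map_mul, eval_X, Pi.smul_apply, smul_eq_mul, mul_comm t]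

theorem _root_.Polynomial.eq_zero_of_eval_eq_zero_of_ne_zero {p : Polynomial ℝ}
    (h : ∀ t : ℝ, t ≠ 0 → p.eval t = 0) : p = 0 := by
  refine Polynomial.eq_zero_of_infinite_isRoot p
    (Set.Infinite.mono (s := ({0}ᶜ : Set ℝ)) (fun t ht => h t ht) ?_)
  exact (Set.finite_singleton (0 : ℝ)).infinite_compl

/-- The cone over `P` is a punctured line, and a univariate real polynomial vanishing off `0` is
zero. As the kernel of a map to a domain, the ideal is visibly prime. -/
theorem idealOfPoints_singleton (P : ℙ ℝ (Fin 3 → ℝ)) :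
    idealOfPoints {P} = RingHom.ker (restrictToSpan P.rep) := by
  ext f
  rw [mem_idealOfPoints, RingHom.mem_ker]
  constructor
  · intro h
    refine Polynomial.eq_zero_of_eval_eq_zero_of_ne_zero fun t ht => ?_
    rw [eval_restrictToSpan]
    exact h _ (mem_coneOver_singleton.2 ⟨t, ht, rfl⟩)
  · intro h v hv
    obtain ⟨t, -, rfl⟩ := mem_coneOver_singleton.1 hv
    rw [← eval_restrictToSpan, h, Polynomial.eval_zero]

theorem isPrime_idealOfPoints_singleton (P : ℙ ℝ (Fin 3 → ℝ)) : (idealOfPoints {P}).IsPrime := by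
  rw [idealOfPoints_singleton]
  exact RingHom.ker_isPrime _

theorem linearForm_mem_idealOfPoints_singleton (l : Fin 3 → ℝ) :
    ∑ j, C (l j) * X j ∈ idealOfPoints {P} ↔ l ⬝ᵥ P.rep = 0 := by
  rw [mem_idealOfPoints]
  have key (v : Fin 3 → ℝ) : eval v (∑ j, C (l j) * X j) = l ⬝ᵥ v := by simp [dotProduct]
  constructor
  · intro h
    rw [← key]
    exact h _ (rep_mem_coneOver rfl)
  · intro h v hv
    obtain ⟨t, -, rfl⟩ := mem_coneOver_singleton.1 hv
    rw [key, dotProduct_smul, h, smul_zero]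

theorem eq_of_idealOfPoints_singleton_le (h : idealOfPoints {Q} ≤ idealOfPoints {P}) : Q = P := by
  have key (i j : Fin 3) : Q.rep i * P.rep j = Q.rep j * P.rep i := by
    -- The forms `Q_i X_j - Q_j X_i` vanish at `Q`; at `P` they are the 2×2 minors that test
    -- proportionality.
    have h1 : ∑ k, C ((Pi.single j (Q.rep i) - Pi.single i (Q.rep j) : Fin 3 → ℝ) k) * X k ∈
        idealOfPoints {Q} := by
      rw [linearForm_mem_idealOfPoints_singleton, sub_dotProduct, single_dotProduct,
        single_dotProduct]
      ring
    have h2 := h h1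
    rw [linearForm_mem_idealOfPoints_singleton, sub_dotProduct, single_dotProduct,
        single_dotProduct] at h2
    linarith
  obtain ⟨i, hi⟩ : ∃ i, P.rep i ≠ 0 := Function.ne_iff.1 P.rep_nonzero
  rw [← Q.mk_rep, ← P.mk_rep, Projectivization.mk_eq_mk_iff']
  refine ⟨Q.rep i / P.rep i, ?_⟩
  ext j
  simp only [Pi.smul_apply, smul_eq_mul]
  field_simp
  linarith [key i j]

theorem eval_smul_of_isHomogeneous {d : ℕ} (hf : f.IsHomogeneous d) (t : ℝ) (v : Fin 3 → ℝ) :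
    eval (t • v) f = t ^ d * eval v f := by
  rw [eval_eq', eval_eq', Finset.mul_sum]
  refine Finset.sum_congr rfl fun e he => ?_
  have hd : ∑ i, e i = d := by
    rw [← hf (mem_support_iff.1 he), Finsupp.weight_apply, Finsupp.sum_fintype _ _ (by simp)]
    simp
  simp only [Pi.smul_apply, smul_eq_mul, mul_pow, Finset.prod_mul_distrib,
    Finset.prod_pow_eq_pow_sum, hd]
  ring

/-- The cone is stable under nonzero scaling, and `t ↦ f (t v)` is a polynomial in `t` whose
coefficients are the values at `v` of the homogeneous components of `f`. -/
theorem homogeneousComponent_mem_idealOfPoints (hf : f ∈ idealOfPoints Z) (d : ℕ) :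
    homogeneousComponent d f ∈ idealOfPoints Z := by
  rw [mem_idealOfPoints] at hf ⊢
  intro v hv
  set p : Polynomial ℝ := ∑ i ∈ Finset.range (f.totalDegree + 1),
    Polynomial.C (eval v (homogeneousComponent i f)) * Polynomial.X ^ i with hp
  have hp0 : p = 0 := by
    refine Polynomial.eq_zero_of_eval_eq_zero_of_ne_zero fun t ht => ?_
    rw [← hf _ (smul_mem_coneOver hv ht)]
    conv_rhs => rw [← sum_homogeneousComponent f]
    rw [hp, Polynomial.eval_finsetSum, map_sum]
    refine Finset.sum_congr rfl fun i _ => ?_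
    rw [eval_smul_of_isHomogeneous (homogeneousComponent_isHomogeneous i f), Polynomial.eval_mul,
      Polynomial.eval_C, Polynomial.eval_pow, Polynomial.eval_X, mul_comm]
  by_cases hd : d < f.totalDegree + 1
  · have := congrArg (fun q => Polynomial.coeff q d) hp0
    simpa [hp, Polynomial.coeff_C_mul, Polynomial.coeff_X_pow, Finset.sum_ite_eq, hd] using this
  · rw [homogeneousComponent_eq_zero _ _ (by omega), map_zero]

/-- Take `s` vanishing on `Z \ {P}` but not on `P`: otherwise the prime `I(P)` would contain a
finite intersection of other `I(Q)`, hence one of them. Inverting `s` brings `I(P)` inside the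
extension of `I(Z)`. -/
theorem exists_mul_idealOfPoints_singleton_le (hZ : Z.Finite) (P : ℙ ℝ (Fin 3 → ℝ)) :
    ∃ s ∉ idealOfPoints {P}, ∀ g ∈ idealOfPoints {P}, s * g ∈ idealOfPoints Z := by
  classical
  by_contra! hcon
  have hle : (hZ.toFinset.erase P).inf (fun Q => idealOfPoints {Q}) ≤ idealOfPoints {P} := by
    intro s hs
    by_contra hsP
    obtain ⟨g, hg, hgs⟩ := hcon s hsP
    refine hgs ?_
    rw [idealOfPoints_eq_iInf]
    simp only [Ideal.mem_iInf]
    intro Q hQ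
    by_cases hQP : Q = P
    · subst hQP
      exact Ideal.mul_mem_left _ _ hg
    · refine Ideal.mul_mem_right _ _ ?_
      exact (Finset.inf_le (f := fun Q => idealOfPoints {Q})
        (Finset.mem_erase.2 ⟨hQP, hZ.mem_toFinset.2 hQ⟩)) hs
  obtain ⟨Q, hQ, hQP⟩ := (isPrime_idealOfPoints_singleton P).inf_le'.1 hle
  exact (Finset.mem_erase.1 hQ).1 (eq_of_idealOfPoints_singleton_le hQP)

theorem exists_eq_of_mem_minimalPrimes (hZ : Z.Finite) {p : Ideal (MvPolynomial (Fin 3) ℝ)}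
    (hp : p ∈ (idealOfPoints Z).minimalPrimes) : ∃ P ∈ Z, p = idealOfPoints {P} := by
  have hle : hZ.toFinset.inf (fun Q => idealOfPoints {Q}) ≤ p := by
    refine le_trans ?_ hp.1.2
    rw [idealOfPoints_eq_iInf, Finset.inf_eq_iInf]
    simp
  obtain ⟨P, hP, hPp⟩ := hp.1.1.inf_le'.1 hle
  rw [hZ.mem_toFinset] at hP
  refine ⟨P, hP, le_antisymm (hp.2 ⟨isPrime_idealOfPoints_singleton P, ?_⟩ hPp) hPp⟩
  rw [idealOfPoints_eq_iInf]
  exact iInf₂_le P hP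

theorem vanishingToOrder_le_symbolicPower (hZ : Z.Finite) (m : ℕ) :
    vanishingToOrder Z m ≤ symbolicPower (idealOfPoints Z) m := by
  intro f hf
  simp only [symbolicPower, Ideal.mem_iInf]
  intro p hp
  have : p.IsPrime := hp.1.1
  obtain ⟨P, hP, hpP⟩ := exists_eq_of_mem_minimalPrimes hZ hp
  obtain ⟨s, hs, hsI⟩ := exists_mul_idealOfPoints_singleton_le hZ P
  simp only [vanishingToOrder, Ideal.mem_iInf] at hf
  have h1 : s ^ m * f ∈ idealOfPoints Z ^ m := by
    have h2 : Ideal.span {s} * idealOfPoints {P} ≤ idealOfPoints Z := by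
      rw [Ideal.span_singleton_mul_le_iff]
      exact hsI
    refine Ideal.pow_right_mono h2 m ?_
    rw [mul_pow, Ideal.span_singleton_pow]
    exact Ideal.mul_mem_mul (Ideal.mem_span_singleton_self _) (hf P hP)
  rw [Ideal.mem_comap]
  have h3 : IsUnit (algebraMap _ (Localization.AtPrime p) (s ^ m)) := by
    refine IsLocalization.map_units (M := p.primeCompl) _ ⟨s ^ m, ?_⟩
    intro h
    exact hs (hpP ▸ hp.1.1.mem_of_pow_mem m h)
  have h4 := Ideal.mem_map_of_mem (algebraMap _ (Localization.AtPrime p)) h1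
  rw [map_mul] at h4
  exact (Ideal.unit_mul_mem_iff_mem _ h3).1 h4

end Ideals
-- Combinatorics of weights modulo `n` in a hexagon
section TorsionVanishing

/-- A family `c` of coefficients on the weight lattice `ℤ × ℤ` of the group `SU(3)`, supported in the
hexagon of radius `d`, invariant under the rotation of order three, and with vanishing sum over
each class modulo `n`. -/
structure IsTorsionVanishing (n d : ℤ) (c : ℤ × ℤ → ℂ) : Prop where
  support : ∀ a b, c (a, b) ≠ 0 →
    (-d ≤ a ∧ a ≤ d) ∧ (-d ≤ b ∧ b ≤ d) ∧ (-d ≤ a - b ∧ a - b ≤ d)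
  rotate : ∀ a b, c (-b, a - b) = c (a, b)
  sum_eq_zero : ∀ (S : Finset (ℤ × ℤ)) (a b : ℤ), (∀ p ∈ S, n ∣ p.1 - a ∧ n ∣ p.2 - b) →
    (∀ p, c p ≠ 0 → n ∣ p.1 - a → n ∣ p.2 - b → p ∈ S) → ∑ p ∈ S, c p = 0

namespace IsTorsionVanishing

variable {n d e : ℤ} {c c' : ℤ × ℤ → ℂ}

theorem eq_zero_of_notMem (hc : IsTorsionVanishing n d c) {a b : ℤ}
    (h : ¬ ((-d ≤ a ∧ a ≤ d) ∧ (-d ≤ b ∧ b ≤ d) ∧ (-d ≤ a - b ∧ a - b ≤ d))) : c (a, b) = 0 := by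
  by_contra h0
  exact h (hc.support a b h0)

theorem _root_.eq_zero_or_eq_neg_one_of_mul_bounds {n d p k : ℤ} (hn : 0 < n) (h1 : d < p + n)
    (h2 : p - 2 * n < -d) (h3 : -d ≤ p + n * k) (h4 : p + n * k ≤ d) : k = 0 ∨ k = -1 := by
  have : k < 1 := by
    by_contra! h
    nlinarith
  have : -2 < k := by
    by_contra! h
    nlinarith
  omega

/-- The bounds on `p` and `q` leave only the shifts by `0` and `-n` in each coordinate, and the
bounds on `p - q` push the mixed shifts out of the hexagon. The class of `(p, q)` thus contributes
just two weights. -/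
theorem apply_add_apply_sub (hc : IsTorsionVanishing n d c) (hn : 0 < n) {p q : ℤ}
    (hp : d < p + n) (hp' : p - 2 * n < -d) (hq : d < q + n) (hq' : q - 2 * n < -d)
    (h : p - q < n - d) (h' : q - p < n - d) : c (p, q) + c (p - n, q - n) = 0 := by
  have hne : ((p, q) : ℤ × ℤ) ≠ (p - n, q - n) := by
    intro h0
    have := congrArg Prod.fst h0
    simp only at this
    omega
  rw [← Finset.sum_pair hne]
  refine hc.sum_eq_zero _ p q ?_ ?_
  · intro x hx
    simp only [Finset.mem_insert, Finset.mem_singleton] at hx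
    rcases hx with rfl | rfl
    · simp
    · exact ⟨⟨-1, by ring⟩, ⟨-1, by ring⟩⟩
  · rintro ⟨x, y⟩ hxy ⟨j, hj⟩ ⟨k, hk⟩
    simp only at hj hk
    obtain rfl : x = p + n * j := by omega
    obtain rfl : y = q + n * k := by omega
    obtain ⟨⟨h1, h2⟩, ⟨h3, h4⟩, h5, h6⟩ := hc.support _ _ hxy
    rcases eq_zero_or_eq_neg_one_of_mul_bounds hn hp hp' h1 h2 with rfl | rfl <;>
    rcases eq_zero_or_eq_neg_one_of_mul_bounds hn hq hq' h3 h4 with rfl | rfl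
    · simp
    · omega
    · omega
    · simp [sub_eq_add_neg]

/-- For `n = 12`, the weights fixed by the rotation modulo `12` do not contribute. -/
theorem apply_eq_zero_of_fixed (hc : IsTorsionVanishing 12 8 c) {p q : ℤ}
    (h : p = 4 ∧ q = 8 ∨ p = 8 ∧ q = 4) : c (p, q) = 0 ∧ c (p - 12, q - 12) = 0 := by
  have key (S : Finset (ℤ × ℤ)) (z : ℂ) (hS : S.card = 3) (hz : ∀ x ∈ S, c x = z)
      (h0 : ∑ x ∈ S, c x = 0) : z = 0 := by
    rw [Finset.sum_congr rfl hz, Finset.sum_const, hS] at h0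
    simpa using h0
  have hmem (p q : ℤ) (hp : 4 ≤ p ∧ p ≤ 8) (hq : 4 ≤ q ∧ q ≤ 8) (S : Finset (ℤ × ℤ))
      (hS : ∀ j k : ℤ, (j = 0 ∨ j = -1) → (k = 0 ∨ k = -1) → p + 12 * j - (q + 12 * k) ≤ 8 →
        -8 ≤ p + 12 * j - (q + 12 * k) → (p + 12 * j, q + 12 * k) ∈ S) :
      ∀ x, c x ≠ 0 → (12 : ℤ) ∣ x.1 - p → (12 : ℤ) ∣ x.2 - q → x ∈ S := by
    rintro ⟨x, y⟩ hxy ⟨j, hj⟩ ⟨k, hk⟩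
    simp only at hj hk
    obtain rfl : x = p + 12 * j := by omega
    obtain rfl : y = q + 12 * k := by omega
    have := hc.support _ _ hxy
    exact hS j k (by omega) (by omega) (by omega) (by omega)
  rcases h with ⟨rfl, rfl⟩ | ⟨rfl, rfl⟩
  -- The class of `(4, 8)` modulo `12` meets the hexagon of radius `8` in one rotation orbit of
  -- three weights: equal coefficients with sum zero.
  · have h1 := hc.rotate 4 8
    have h2 := hc.rotate (-8) (-4)
    norm_num at h1 h2 ⊢
    have h0 := key {(4, 8), (-8, -4), (4, -4)} (c (4, 8)) (by decide)
      (by simp [h1, h2]) (hc.sum_eq_zero _ 4 8 (by decide) (hmem 4 8 (by simp) (by simp) _ (by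
        rintro j k (rfl | rfl) (rfl | rfl) <;> simp)))
    exact ⟨h0, by rw [h1, h0]⟩
  · have h1 := hc.rotate 8 4
    have h2 := hc.rotate (-4) 4
    norm_num at h1 h2 ⊢
    have h0 := key {(8, 4), (-4, 4), (-4, -8)} (c (8, 4)) (by decide)
      (by simp [h1, h2]) (hc.sum_eq_zero _ 8 4 (by decide) (hmem 8 4 (by simp) (by simp) _ (by
        rintro j k (rfl | rfl) (rfl | rfl) <;> simp)))
    exact ⟨h0, by rw [h2, h1, h0]⟩

theorem mul_apply_eq_of_le (hc : IsTorsionVanishing n d c) (hc' : IsTorsionVanishing n e c')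
    (hn : 12 ≤ n) (hde : d + e = n + 4) (hle : e ≤ d) (p q : ℤ) :
    c (p, q) * c' (n - p, n - q) = c (p - n, q - n) * c' (-p, -q) := by
  have hneg : n - p - n = -p ∧ n - q - n = -q := ⟨by ring, by ring⟩
  -- Since `n - e = d - 4`, this square is preserved by `p ↦ n - p`, `q ↦ n - q`. On it `|p - q| ≤ e
  -- - d + 4`, so the two-weight relation applies to both factors unless `d = e = 8` and `|p - q| =
  -- 4`.
  by_cases hpq : (d - 4 ≤ p ∧ p ≤ e) ∧ (d - 4 ≤ q ∧ q ≤ e)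
  · by_cases hsp : d = 8 ∧ (p - q = 4 ∨ q - p = 4)
    · obtain rfl : d = 8 := hsp.1
      obtain rfl : n = 12 := by omega
      obtain ⟨h1, h2⟩ := hc.apply_eq_zero_of_fixed (p := p) (q := q) (by omega)
      rw [h1, h2, zero_mul, zero_mul]
    · have h1 := hc.apply_add_apply_sub (p := p) (q := q) (by omega) (by omega) (by omega)
        (by omega) (by omega) (by omega) (by omega)
      have h2 := hc'.apply_add_apply_sub (p := n - p) (q := n - q) (by omega) (by omega) (by omega)
        (by omega) (by omega) (by omega) (by omega)
      rw [hneg.1, hneg.2] at h2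
      rw [eq_neg_of_add_eq_zero_left h1, eq_neg_of_add_eq_zero_left h2, neg_mul_neg]
  -- Off the square both sides vanish: if a side were nonzero, the partner of its `c'` weight would
  -- lie outside the smaller hexagon, so the two-weight relation would make the `c'` factor zero.
  · have hl : c (p, q) * c' (n - p, n - q) = 0 := by
      by_contra h0
      have h1 := hc.support _ _ (left_ne_zero_of_mul h0)
      have h2 := hc'.support _ _ (right_ne_zero_of_mul h0)
      have h3 := hc'.apply_add_apply_sub (p := n - p) (q := n - q) (by omega) (by omega) (by omega)
        (by omega) (by omega) (by omega) (by omega)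
      rw [hneg.1, hneg.2, hc'.eq_zero_of_notMem (a := -p) (b := -q) (by omega), add_zero] at h3
      exact right_ne_zero_of_mul h0 h3
    have hr : c (p - n, q - n) * c' (-p, -q) = 0 := by
      by_contra h0
      have h1 := hc.support _ _ (left_ne_zero_of_mul h0)
      have h2 := hc'.support _ _ (right_ne_zero_of_mul h0)
      have h3 := hc'.apply_add_apply_sub (p := n - p) (q := n - q) (by omega) (by omega) (by omega)
        (by omega) (by omega) (by omega) (by omega)
      rw [hneg.1, hneg.2, hc'.eq_zero_of_notMem (a := n - p) (b := n - q) (by omega),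
        zero_add] at h3
      exact right_ne_zero_of_mul h0 h3
    rw [hl, hr]

theorem mul_apply_eq (hc : IsTorsionVanishing n d c) (hc' : IsTorsionVanishing n e c')
    (hn : 12 ≤ n) (hde : d + e = n + 4) (p q : ℤ) :
    c (p, q) * c' (n - p, n - q) = c (p - n, q - n) * c' (-p, -q) := by
  rcases le_total e d with hle | hle
  · exact mul_apply_eq_of_le hc hc' hn hde hle p q
  · have := mul_apply_eq_of_le hc' hc hn (by omega) hle (n - p) (n - q)
    simp only [sub_sub_cancel, neg_sub, sub_sub_cancel_left] at this
    rw [mul_comm, this, mul_comm]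

end IsTorsionVanishing

/-! ### Laurent polynomials on the torus, the Vandermonde determinant and the coefficient functional
-/

/-- The coordinate ring of the maximal torus of `SL(3, ℂ)`. -/
abbrev TorusAlgebra := AddMonoidAlgebra ℂ (ℤ × ℤ)

namespace TorusAlgebra

open AddMonoidAlgebra

/-- The monomial `t₁ ^ a * t₂ ^ b`. -/
def monom (a b : ℤ) : TorusAlgebra := single (a, b) 1

theorem monom_mul (a b c d : ℤ) : monom a b * monom c d = monom (a + c) (b + d) := by
  simp [monom, single_mul_single]

theorem monom_pow (a b : ℤ) (k : ℕ) : monom a b ^ k = monom (k * a) (k * b) := by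
  simp [monom, single_pow]

theorem monom_zero : monom 0 0 = 1 := rfl

theorem coeff_monom (a b : ℤ) (p : ℤ × ℤ) : (monom a b).coeff p = if (a, b) = p then 1 else 0 := by
  simp [monom, Finsupp.single_apply]

theorem coeff_mul_eq_of_isTorsionVanishing {G G' : TorusAlgebra} {n d e : ℤ}
    (hc : IsTorsionVanishing n d G.coeff) (hc' : IsTorsionVanishing n e G'.coeff)
    (hn : 12 ≤ n) (hde : d + e = n + 4) :
    (G * G').coeff (n, n) = (G * G').coeff (-n, -n) := by
  have key (x : ℤ × ℤ) : (G * G').coeff x = ∑ᶠ p : ℤ × ℤ, G.coeff p * G'.coeff (-p + x) := by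
    rw [coeff_mul_apply_left, finsum_eq_sum_of_support_subset (s := G.coeff.support)]
    · rfl
    · intro p hp
      simpa using left_ne_zero_of_mul hp
  rw [key, key]
  -- Shifting the index of the second convolution by `(n, n)` turns the claim into the termwise
  -- identity `mul_apply_eq`.
  refine Eq.trans (finsum_congr fun p => ?_) (finsum_comp_equiv (Equiv.subRight ((n, n) : ℤ × ℤ)))
  obtain ⟨p, q⟩ := p
  convert hc.mul_apply_eq hc' hn hde p q using 3
  · ext <;> simp <;> ring
  · simp
  · ext <;> simp <;> ring

/-- The Laurent polynomials supported in the hexagon of radius `d`. -/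
def hexagonal (d : ℤ) : Submodule ℂ TorusAlgebra where
  carrier := {g | ∀ a b, g.coeff (a, b) ≠ 0 →
    (-d ≤ a ∧ a ≤ d) ∧ (-d ≤ b ∧ b ≤ d) ∧ (-d ≤ a - b ∧ a - b ≤ d)}
  zero_mem' := by simp
  add_mem' := by
    intro g h hg hh a b hab
    by_cases h0 : g.coeff (a, b) = 0
    · exact hh a b (by simpa [h0] using hab)
    · exact hg a b h0
  smul_mem' := by
    intro r g hg a b hab
    exact hg a b (right_ne_zero_of_mul (by simpa using hab))

theorem monom_mem_hexagonal {a b d : ℤ} (h : (-d ≤ a ∧ a ≤ d) ∧ (-d ≤ b ∧ b ≤ d) ∧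
    (-d ≤ a - b ∧ a - b ≤ d)) : monom a b ∈ hexagonal d := by
  intro a' b' h0
  rw [coeff_monom] at h0
  have := (ite_ne_right_iff.1 h0).1
  simp only [Prod.mk.injEq] at this
  rwa [← this.1, ← this.2]

theorem mul_mem_hexagonal {g h : TorusAlgebra} {d e : ℤ} (hg : g ∈ hexagonal d)
    (hh : h ∈ hexagonal e) : g * h ∈ hexagonal (d + e) := by
  rintro a b hab
  rw [coeff_mul_apply_left] at hab
  obtain ⟨⟨p, q⟩, hp, hpq⟩ := Finset.exists_ne_zero_of_sum_ne_zero hab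
  have h1 := hg p q (left_ne_zero_of_mul hpq)
  have h2 := hh (-p + a) (-q + b) (right_ne_zero_of_mul hpq)
  omega

/-- The evaluation of Laurent polynomials at a point of the compact torus. -/
def evalCircle (s t : Circle) : TorusAlgebra →ₐ[ℂ] ℂ :=
  AddMonoidAlgebra.lift ℂ ℂ (ℤ × ℤ)
    { toFun := fun p => ((s ^ p.toAdd.1 * t ^ p.toAdd.2 : Circle) : ℂ)
      map_one' := by simp
      map_mul' := fun p q => by
        simp only [toAdd_mul, Prod.fst_add, Prod.snd_add, zpow_add]
        push_cast
        ring }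

theorem evalCircle_apply (s t : Circle) (g : TorusAlgebra) :
    evalCircle s t g = g.coeff.sum fun p r => r * ((s : ℂ) ^ p.1 * (t : ℂ) ^ p.2) := by
  rw [evalCircle, AddMonoidAlgebra.lift_apply]
  simp [Finsupp.sum]

theorem evalCircle_monom (s t : Circle) (a b : ℤ) :
    evalCircle s t (monom a b) = (s : ℂ) ^ a * (t : ℂ) ^ b := by
  simp [monom, evalCircle]

theorem _root_.IsPrimitiveRoot.sum_zpow_pow {ζ : ℂ} {n : ℕ} (hζ : IsPrimitiveRoot ζ n) (k : ℤ) :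
    ∑ i ∈ Finset.range n, (ζ ^ k) ^ i = if (n : ℤ) ∣ k then (n : ℂ) else 0 := by
  split_ifs with h
  · rw [(hζ.zpow_eq_one_iff_dvd k).2 h]
    simp
  · have h1 : ζ ^ k ≠ 1 := fun h1 => h ((hζ.zpow_eq_one_iff_dvd k).1 h1)
    rw [geom_sum_eq h1, ← zpow_natCast, ← zpow_mul, mul_comm k, zpow_mul, zpow_natCast,
      hζ.pow_eq_one]
    simp

/-- Fourier inversion on `(ℤ/n)²`: averaging the values at torsion points against a character
isolates one class of exponents. -/
theorem sum_coeff_eq_zero_of_evalCircle_eq_zero {g : TorusAlgebra} {n : ℕ} (hn : 0 < n)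
    (hg : ∀ s t : Circle, s ^ n = 1 → t ^ n = 1 → evalCircle s t g = 0) (a b : ℤ) :
    ∑ p ∈ g.coeff.support with (n : ℤ) ∣ p.1 - a ∧ (n : ℤ) ∣ p.2 - b, g.coeff p = 0 := by
  set z : Circle := Circle.exp (2 * Real.pi / n) with hz
  have hn0 : (n : ℂ) ≠ 0 := by exact_mod_cast hn.ne'
  have hprim : IsPrimitiveRoot (z : ℂ) n := by
    convert Complex.isPrimitiveRoot_exp n hn.ne' using 1
    rw [hz, Circle.coe_exp]
    congr 1
    push_cast
    ring
  have hzn : z ^ n = 1 := Circle.ext (by push_cast; exact hprim.pow_eq_one)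
  have hz0 : (z : ℂ) ≠ 0 := Circle.coe_ne_zero z
  have h1 : ∑ i ∈ Finset.range n, ∑ j ∈ Finset.range n,
      ((z : ℂ) ^ (-a)) ^ i * ((z : ℂ) ^ (-b)) ^ j * evalCircle (z ^ i) (z ^ j) g = 0 := by
    refine Finset.sum_eq_zero fun i _ => Finset.sum_eq_zero fun j _ => ?_
    rw [hg _ _ (by rw [pow_right_comm, hzn, one_pow]) (by rw [pow_right_comm, hzn, one_pow]),
      mul_zero]
  have h2 : ∑ p ∈ g.coeff.support, g.coeff p *
      ((∑ i ∈ Finset.range n, ((z : ℂ) ^ (p.1 - a)) ^ i) *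
        ∑ j ∈ Finset.range n, ((z : ℂ) ^ (p.2 - b)) ^ j) = 0 := by
    rw [← h1]
    simp only [evalCircle_apply, Finsupp.sum, Finset.sum_mul_sum]
    simp only [Finset.mul_sum]
    rw [Finset.sum_comm]
    refine Finset.sum_congr rfl fun i _ => ?_
    rw [Finset.sum_comm]
    refine Finset.sum_congr rfl fun j _ => Finset.sum_congr rfl fun p _ => ?_
    rw [sub_eq_add_neg, sub_eq_add_neg, zpow_add₀ hz0, zpow_add₀ hz0, mul_pow, mul_pow]
    push_cast
    rw [← zpow_natCast, ← zpow_natCast, ← zpow_natCast, ← zpow_natCast, ← zpow_natCast,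
      ← zpow_natCast, ← zpow_mul (z : ℂ) (i : ℤ), ← zpow_mul (z : ℂ) (j : ℤ), ← zpow_mul _ p.1,
      ← zpow_mul _ p.2, mul_comm (i : ℤ), mul_comm (j : ℤ)]
    ring
  simp only [hprim.sum_zpow_pow] at h2
  refine (mul_left_inj' (mul_ne_zero hn0 hn0)).1 (Eq.trans ?_ (h2.trans (zero_mul _).symm))
  rw [Finset.sum_filter, Finset.sum_mul]
  refine Finset.sum_congr rfl fun p _ => ?_
  by_cases ha : (n : ℤ) ∣ p.1 - a <;> by_cases hb : (n : ℤ) ∣ p.2 - b <;> simp [ha, hb]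

/-- The Vandermonde determinant in `t₁`, `t₂` and `t₃ = (t₁ t₂)⁻¹`. -/
def vandermonde : TorusAlgebra :=
  monom 1 2 + monom (-2) (-1) + monom 1 (-1) - (monom 2 1 + monom (-1) 1 + monom (-1) (-2))

theorem vandermonde_mem_hexagonal : vandermonde ∈ hexagonal 2 := by
  refine sub_mem (add_mem (add_mem ?_ ?_) ?_) (add_mem (add_mem ?_ ?_) ?_) <;>
  exact monom_mem_hexagonal (by norm_num)

theorem evalCircle_vandermonde (s t : Circle) :
    evalCircle s t vandermonde =
      ((s : ℂ) - t) * (t - (s * t : ℂ)⁻¹) * ((s * t : ℂ)⁻¹ - s) := by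
  have hs := Circle.coe_ne_zero s
  have ht := Circle.coe_ne_zero t
  simp only [vandermonde, map_add, map_sub, evalCircle_monom, zpow_neg, zpow_ofNat]
  field_simp
  ring

/-- The rotation `t₁ ↦ t₂ ↦ t₃ ↦ t₁`. -/
def rotate : TorusAlgebra →ₐ[ℂ] TorusAlgebra :=
  mapDomainAlgHom ℂ ℂ
    { toFun := fun p : ℤ × ℤ => (-p.2, p.1 - p.2)
      map_zero' := by simp
      map_add' := fun p q => by ext <;> simp <;> ring }

theorem rotate_monom (a b : ℤ) : rotate (monom a b) = monom (-b) (a - b) := by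
  simp [rotate, monom]

theorem coeff_rotate (g : TorusAlgebra) (a b : ℤ) :
    (rotate g).coeff (-b, a - b) = g.coeff (a, b) := by
  induction g using AddMonoidAlgebra.induction_linear with
  | zero => simp
  | add f g hf hg => simp [hf, hg]
  | single p r =>
    obtain ⟨x, y⟩ := p
    simp only [rotate, mapDomainAlgHom_apply, mapDomain_single, coeff_single, Finsupp.single_apply]
    simp only [AddMonoidHom.coe_mk, ZeroHom.coe_mk, Prod.mk.injEq]
    refine if_congr ?_ rfl rfl
    omega

theorem rotate_vandermonde : rotate vandermonde = vandermonde := by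
  simp only [vandermonde, map_add, map_sub, rotate_monom]
  norm_num
  abel

theorem isTorsionVanishing_coeff {g : TorusAlgebra} {n : ℕ} {d : ℤ} (hn : 0 < n)
    (hd : g ∈ hexagonal d) (hr : rotate g = g)
    (hg : ∀ s t : Circle, s ^ n = 1 → t ^ n = 1 → evalCircle s t g = 0) :
    IsTorsionVanishing n d g.coeff where
  support := hd
  rotate := fun a b => by
    conv_lhs => rw [← hr]
    exact coeff_rotate g a b
  sum_eq_zero := fun S a b hS hS' => by
    rw [← sum_coeff_eq_zero_of_evalCircle_eq_zero hn hg a b]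
    symm
    refine Finset.sum_subset_zero_on_sdiff ?_ ?_ fun _ _ => rfl
    · intro p hp
      simp only [Finset.mem_filter, Finsupp.mem_support_iff] at hp
      exact hS' p hp.1 hp.2.1 hp.2.2
    · intro p hp
      simp only [Finset.mem_sdiff, Finset.mem_filter, Finsupp.mem_support_iff] at hp
      by_contra h0
      exact hp.2 ⟨h0, hS p hp.1⟩

/-- The elementary symmetric function `t₁ + t₂ + t₃`. -/
def elemOne : TorusAlgebra := monom 1 0 + monom 0 1 + monom (-1) (-1)

/-- The elementary symmetric function `t₁ t₂ + t₁ t₃ + t₂ t₃`. -/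
def elemTwo : TorusAlgebra := monom (-1) 0 + monom 0 (-1) + monom 1 1

/-- The homomorphism `ℝ[x, y, z] → ℂ[t₁, t₂, t₃] / (t₁ t₂ t₃ - 1)` which sends `z` to `1`, and
`x + i y`, `x - i y` to the elementary symmetric functions. -/
def ofMvPolynomial : MvPolynomial (Fin 3) ℝ →ₐ[ℝ] TorusAlgebra :=
  aeval ![(1 / 2 : ℂ) • (elemOne + elemTwo), (-Complex.I / 2) • (elemOne - elemTwo), 1]

theorem elemOne_mem_hexagonal : elemOne ∈ hexagonal 1 := by
  refine add_mem (add_mem ?_ ?_) ?_ <;> exact monom_mem_hexagonal (by norm_num)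

theorem elemTwo_mem_hexagonal : elemTwo ∈ hexagonal 1 := by
  refine add_mem (add_mem ?_ ?_) ?_ <;> exact monom_mem_hexagonal (by norm_num)

theorem ofMvPolynomial_X_mem_hexagonal (i : Fin 3) : ofMvPolynomial (X i) ∈ hexagonal 1 := by
  have h1 : (1 : TorusAlgebra) ∈ hexagonal 1 := by
    rw [← monom_zero]
    exact monom_mem_hexagonal (by norm_num)
  rw [ofMvPolynomial, aeval_X]
  fin_cases i
  · exact Submodule.smul_mem _ _ (add_mem elemOne_mem_hexagonal elemTwo_mem_hexagonal)
  · exact Submodule.smul_mem _ _ (sub_mem elemOne_mem_hexagonal elemTwo_mem_hexagonal)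
  · exact h1

theorem pow_mem_hexagonal {g : TorusAlgebra} (hg : g ∈ hexagonal 1) (k : ℕ) :
    g ^ k ∈ hexagonal k := by
  induction k with
  | zero =>
    rw [pow_zero, ← monom_zero]
    exact monom_mem_hexagonal (by norm_num)
  | succ k ih =>
    rw [pow_succ]
    push_cast
    exact mul_mem_hexagonal ih hg

theorem ofMvPolynomial_mem_hexagonal {f : MvPolynomial (Fin 3) ℝ} {d : ℕ}
    (hf : f.IsHomogeneous d) : ofMvPolynomial f ∈ hexagonal d := by
  rw [f.as_sum, map_sum]
  refine sum_mem fun e he => ?_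
  have hd : ∑ i, e i = d := by
    rw [← hf (mem_support_iff.1 he), Finsupp.weight_apply, Finsupp.sum_fintype _ _ (by simp)]
    simp
  rw [monomial_eq, Finsupp.prod_fintype _ _ (by simp), map_mul, ← algebraMap_eq,
    AlgHom.commutes, ← Algebra.smul_def, ← Complex.coe_smul]
  refine Submodule.smul_mem _ _ ?_
  rw [map_prod, Fin.prod_univ_three]
  simp only [map_pow]
  rw [← hd, Fin.sum_univ_three]
  push_cast
  exact mul_mem_hexagonal (mul_mem_hexagonal
    (pow_mem_hexagonal (ofMvPolynomial_X_mem_hexagonal _) _)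
    (pow_mem_hexagonal (ofMvPolynomial_X_mem_hexagonal _) _))
    (pow_mem_hexagonal (ofMvPolynomial_X_mem_hexagonal _) _)

theorem rotate_ofMvPolynomial (f : MvPolynomial (Fin 3) ℝ) :
    rotate (ofMvPolynomial f) = ofMvPolynomial f := by
  have h1 : rotate elemOne = elemOne := by
    simp only [elemOne, map_add, rotate_monom]
    norm_num
    abel
  have h2 : rotate elemTwo = elemTwo := by
    simp only [elemTwo, map_add, rotate_monom]
    norm_num
    abel
  have : (rotate.restrictScalars ℝ).comp ofMvPolynomial = ofMvPolynomial := by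
    ext1 i
    fin_cases i <;> simp [ofMvPolynomial, h1, h2]
  exact DFunLike.congr_fun this f

/-- Homogeneous coordinates of the point `s + t + (s t)⁻¹` of the complex plane. -/
def _root_.sumVector (s t : Circle) : Fin 3 → ℝ :=
  ![((s : ℂ) + t + (s * t : ℂ)⁻¹).re, ((s : ℂ) + t + (s * t : ℂ)⁻¹).im, 1]

theorem evalCircle_elemOne (s t : Circle) :
    evalCircle s t elemOne = (s : ℂ) + t + (s * t : ℂ)⁻¹ := by
  simp [elemOne, evalCircle_monom, mul_comm]

theorem evalCircle_elemTwo (s t : Circle) :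
    evalCircle s t elemTwo = (starRingEnd ℂ) ((s : ℂ) + t + (s * t : ℂ)⁻¹) := by
  simp only [elemTwo, map_add, evalCircle_monom, map_inv₀, map_mul, ← Circle.coe_inv_eq_conj]
  simp [mul_comm]

theorem evalCircle_ofMvPolynomial (s t : Circle) (f : MvPolynomial (Fin 3) ℝ) :
    evalCircle s t (ofMvPolynomial f) = (eval (sumVector s t) f : ℝ) := by
  have : ((evalCircle s t).restrictScalars ℝ).comp ofMvPolynomial =
      Complex.ofRealAm.comp (aeval (sumVector s t)) := by
    ext1 i
    fin_cases i
    · have : evalCircle s t (ofMvPolynomial (X 0)) = (((s : ℂ) + t + (s * t : ℂ)⁻¹).re : ℂ) := by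
        rw [Complex.re_eq_add_conj, ofMvPolynomial, aeval_X, Matrix.cons_val_zero, map_smul,
          map_add, evalCircle_elemOne, evalCircle_elemTwo, smul_eq_mul]
        ring
      simpa [sumVector] using this
    · have : evalCircle s t (ofMvPolynomial (X 1)) = (((s : ℂ) + t + (s * t : ℂ)⁻¹).im : ℂ) := by
        rw [Complex.im_eq_sub_conj, ofMvPolynomial, aeval_X, Matrix.cons_val_one,
          Matrix.cons_val_zero, map_smul,
          map_sub, evalCircle_elemOne, evalCircle_elemTwo, smul_eq_mul]
        generalize (s : ℂ) + t + (s * t : ℂ)⁻¹ - _ = w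
        field_simp
        linear_combination -w * Complex.I_sq
      simpa [sumVector] using this
    · simp [ofMvPolynomial, sumVector]
  have h2 := DFunLike.congr_fun this f
  simpa [aeval_eq_eval] using h2

/-- One factor `V` goes to each of `f` and `g`, supplying the missing zeros at torsion points with
repeated coordinates. Rotation is an even permutation, so `V` is invariant under it. -/
theorem coeff_vandermonde_sq_mul_eq {f g : MvPolynomial (Fin 3) ℝ} {n a b : ℕ} (hn : 12 ≤ n)
    (hab : a + b = n) (hf : f.IsHomogeneous a) (hg : g.IsHomogeneous b)
    (hf0 : ∀ s t : Circle, s ^ n = 1 → t ^ n = 1 → s ≠ t → t ≠ (s * t)⁻¹ → (s * t)⁻¹ ≠ s →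
      eval (sumVector s t) f = 0)
    (hg0 : ∀ s t : Circle, s ^ n = 1 → t ^ n = 1 → s ≠ t → t ≠ (s * t)⁻¹ → (s * t)⁻¹ ≠ s →
      eval (sumVector s t) g = 0) :
    (vandermonde * vandermonde * ofMvPolynomial (f * g)).coeff (n, n) =
      (vandermonde * vandermonde * ofMvPolynomial (f * g)).coeff (-n, -n) := by
  have key (f : MvPolynomial (Fin 3) ℝ) (a : ℕ) (hf : f.IsHomogeneous a)
      (hf0 : ∀ s t : Circle, s ^ n = 1 → t ^ n = 1 → s ≠ t → t ≠ (s * t)⁻¹ → (s * t)⁻¹ ≠ s →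
        eval (sumVector s t) f = 0) :
      IsTorsionVanishing n (2 + a) (vandermonde * ofMvPolynomial f).coeff := by
    refine isTorsionVanishing_coeff (by omega)
      (mul_mem_hexagonal vandermonde_mem_hexagonal (ofMvPolynomial_mem_hexagonal hf))
      (by rw [map_mul, rotate_vandermonde, rotate_ofMvPolynomial]) fun s t hs ht => ?_
    rw [map_mul, evalCircle_ofMvPolynomial, evalCircle_vandermonde]
    by_cases h1 : s = t
    · simp [h1]
    by_cases h2 : t = (s * t)⁻¹
    · have : (t : ℂ) = (s * t : ℂ)⁻¹ := by exact_mod_cast congrArg (Subtype.val) h2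
      rw [← this]
      simp
    by_cases h3 : (s * t)⁻¹ = s
    · have : (s * t : ℂ)⁻¹ = s := by exact_mod_cast congrArg (Subtype.val) h3
      rw [this]
      simp
    rw [hf0 s t hs ht h1 h2 h3]
    simp
  have := coeff_mul_eq_of_isTorsionVanishing (key f a hf hf0) (key g b hg hg0)
    (by exact_mod_cast hn) (by push_cast [← hab]; ring)
  rw [map_mul]
  convert this using 2 <;> ring_nf

theorem coeff_vandermonde_sq_mul_monom (a b : ℤ) (p : ℤ × ℤ) :
    (vandermonde * vandermonde * monom a b).coeff p =
      (vandermonde * vandermonde).coeff (p.1 - a, p.2 - b) := by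
  rw [monom, coeff_mul_single_apply, mul_one]
  rfl

theorem coeff_vandermonde_sq_zero : (vandermonde * vandermonde).coeff (0, 0) = -6 := by
  simp only [vandermonde, mul_add, add_mul, mul_sub, sub_mul, monom_mul, AddMonoidAlgebra.coeff_add,
    AddMonoidAlgebra.coeff_sub,
    Finsupp.add_apply, Finsupp.sub_apply, coeff_monom]
  norm_num

theorem coeff_vandermonde_sq_mul_ne {n : ℕ} (hn : 5 ≤ n) :
    (vandermonde * vandermonde * ((monom 1 0 ^ n - 1) * (monom 0 1 ^ n - 1) *
      (monom (-1) (-1) ^ n - 1))).coeff (n, n) ≠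
    (vandermonde * vandermonde * ((monom 1 0 ^ n - 1) * (monom 0 1 ^ n - 1) *
      (monom (-1) (-1) ^ n - 1))).coeff (-n, -n) := by
  have hexp : (monom 1 0 ^ n - 1) * (monom 0 1 ^ n - 1) * (monom (-1) (-1) ^ n - 1) =
      monom n 0 + monom 0 n + monom (-n) (-n) - monom n n - monom (-n) 0 - monom 0 (-n) := by
    simp only [monom_pow, mul_sub, sub_mul, monom_mul, mul_one, one_mul, mul_zero]
    simp only [← monom_zero]
    ring_nf
  -- `V²` lives in radius `4 < n`, so of the six monomials only the one at the chosen weight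
  -- contributes there.
  have h0 (a b : ℤ) (h : ¬ ((-4 ≤ a ∧ a ≤ 4) ∧ (-4 ≤ b ∧ b ≤ 4) ∧ (-4 ≤ a - b ∧ a - b ≤ 4))) :
      (vandermonde * vandermonde).coeff (a, b) = 0 := by
    by_contra h1
    exact h (mul_mem_hexagonal vandermonde_mem_hexagonal vandermonde_mem_hexagonal a b h1)
  rw [hexp]
  simp only [mul_add, mul_sub, AddMonoidAlgebra.coeff_add,
    AddMonoidAlgebra.coeff_sub, Finsupp.add_apply, Finsupp.sub_apply,
    coeff_vandermonde_sq_mul_monom]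
  have h6 : (vandermonde * vandermonde).coeff ((n : ℤ) - n, (n : ℤ) - n) = -6 := by
    rw [sub_self, coeff_vandermonde_sq_zero]
  have h6' : (vandermonde * vandermonde).coeff (-(n : ℤ) - -n, -(n : ℤ) - -n) = -6 := by
    rw [sub_self, coeff_vandermonde_sq_zero]
  rw [h6, h6']
  repeat rw [h0 _ _ (by omega)]
  norm_num

end TorusAlgebra

end TorsionVanishing

/-! ### Equations of the lines and their incidences -/

namespace FurediPalasti

open TorusAlgebra

/-- The point `exp (2πi/n) ^ j` of the unit circle. -/
def root (n : ℕ) (j : ℤ) : Circle := Circle.exp (2 * Real.pi * j / n)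

theorem root_add (n : ℕ) (i j : ℤ) : root n (i + j) = root n i * root n j := by
  rw [root, root, root, ← Circle.exp_add]
  congr 1
  push_cast
  ring

theorem isPrimitiveRoot_root {n : ℕ} (hn : n ≠ 0) : IsPrimitiveRoot (root n 1 : ℂ) n := by
  convert Complex.isPrimitiveRoot_exp n hn using 1
  rw [root, Circle.coe_exp]
  congr 1
  push_cast
  ring

theorem root_eq_zpow (n : ℕ) (j : ℤ) : root n j = root n 1 ^ j := by
  rw [root, root, ← Circle.exp_intCast_mul]
  congr 1
  push_cast
  ring

theorem root_eq_one_iff {n : ℕ} (hn : n ≠ 0) (j : ℤ) : root n j = 1 ↔ (n : ℤ) ∣ j := by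
  rw [← (isPrimitiveRoot_root hn).zpow_eq_one_iff_dvd, root_eq_zpow, ← Circle.coe_inj]
  simp

theorem root_eq_root_iff {n : ℕ} (hn : n ≠ 0) {i j : ℕ} (hi : i < n) (hj : j < n) :
    root n i = root n j ↔ i = j := by
  refine ⟨fun h => ?_, fun h => by rw [h]⟩
  rw [root_eq_zpow, root_eq_zpow n j, ← Circle.coe_inj] at h
  push_cast at h
  rw [zpow_natCast, zpow_natCast] at h
  exact (isPrimitiveRoot_root hn).pow_inj hi hj h

theorem exists_root_eq {n : ℕ} (hn : n ≠ 0) {s : Circle} (hs : s ^ n = 1) :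
    ∃ i < n, root n (i : ℕ) = s := by
  have : NeZero n := ⟨hn⟩
  obtain ⟨i, hi, h⟩ := (isPrimitiveRoot_root hn).eq_pow_of_pow_eq_one (ξ := (s : ℂ))
    (by exact_mod_cast congrArg Subtype.val hs)
  refine ⟨i, hi, ?_⟩
  rw [root_eq_zpow, ← Circle.coe_inj]
  push_cast
  rw [zpow_natCast, h]

theorem root_pow (n : ℕ) (hn : n ≠ 0) (i : ℤ) : root n i ^ n = 1 := by
  rw [root_eq_zpow, ← Circle.coe_inj]
  push_cast
  rw [← zpow_natCast, ← zpow_mul, mul_comm, zpow_mul, zpow_natCast,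
    (isPrimitiveRoot_root hn).pow_eq_one, one_zpow]

theorem prod_sub_root {n : ℕ} (hn : n ≠ 0) {A : Type*} [CommRing A] [Algebra ℂ A] (a : A) :
    ∏ i ∈ Finset.range n, (a - algebraMap ℂ A (root n (i : ℕ))) = a ^ n - 1 := by
  have : NeZero n := ⟨hn⟩
  have hprim := isPrimitiveRoot_root hn
  have h := congrArg (Polynomial.aeval a) (Polynomial.X_pow_sub_one_eq_prod (Nat.pos_of_ne_zero hn) hprim)
  simp only [map_sub, map_pow, Polynomial.aeval_X, map_one, map_prod, Polynomial.aeval_C] at h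
  rw [h]
  refine Finset.prod_nbij (fun i => (root n i : ℂ)) ?_ ?_ ?_ fun _ _ => rfl
  · intro i _
    rw [Polynomial.mem_nthRootsFinset (Nat.pos_of_ne_zero hn)]
    exact_mod_cast congrArg Subtype.val (root_pow n hn i)
  · intro i hi j hj hij
    exact (root_eq_root_iff hn (by simpa using hi) (by simpa using hj)).1 (Circle.coe_inj.1 hij)
  · intro s hs
    rw [Finset.mem_coe, Polynomial.mem_nthRootsFinset (Nat.pos_of_ne_zero hn)] at hs
    obtain ⟨i, hi, rfl⟩ := hprim.eq_pow_of_pow_eq_one hs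
    refine ⟨i, by simpa using hi, ?_⟩
    simp [root_eq_zpow n i]

/-- With `a = πi/n` the endpoints have angles `2a` and `π - 4a`. They coincide iff `cos (3a) = 0`;
dividing the cross product by `-2 cos (3a)` gives a form that also covers the tangent case. -/
theorem lineCoeff_eq_smul {n : ℕ} (hn : n ≠ 0) (heven : Even n) (i : ℕ) :
    ∃ r : ℝ, r ≠ 0 ∧ lineCoeff n i = r • ![Real.sin (Real.pi * i / n), Real.cos (Real.pi * i / n),
      -Real.sin (3 * (Real.pi * i / n))] := by
  obtain ⟨h, rfl⟩ := heven
  have hh : (h : ℝ) ≠ 0 := by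
    intro h0
    exact hn (by simpa using h0)
  set a : ℝ := Real.pi * i / ((h + h : ℕ) : ℝ) with ha
  have hk : (((h + h : ℕ) : ℤ) / 2 - 2 * (i : ℤ)) = (h : ℤ) - 2 * i := by omega
  have hα : 2 * Real.pi * ((i : ℤ) : ℝ) / ((h + h : ℕ) : ℝ) = 2 * a := by
    rw [ha]
    push_cast
    ring
  have hβ : 2 * Real.pi * (((h : ℤ) - 2 * i : ℤ) : ℝ) / ((h + h : ℕ) : ℝ) = Real.pi - 4 * a := by
    rw [ha]
    push_cast
    field_simp
    ring
  have hcos : Real.cos (3 * a) = 0 ↔ (i : ℤ) ≡ (h : ℤ) - 2 * i [ZMOD (h + h : ℕ)] := by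
    rw [Real.cos_eq_zero_iff, Int.modEq_iff_dvd]
    have haa : a * (2 * h) = Real.pi * i := by
      rw [ha]
      push_cast
      field_simp
      ring
    constructor
    · rintro ⟨k, hk⟩
      refine ⟨-k, ?_⟩
      have h1 : (3 * i : ℝ) = (2 * k + 1) * h := by
        have := Real.pi_ne_zero
        have h2 : Real.pi * (3 * i) = Real.pi * ((2 * k + 1) * h) := by
          linear_combination (2 * h : ℝ) * hk - 3 * haa
        exact mul_left_cancel₀ this h2
      have h3 : (3 * i : ℤ) = (2 * k + 1) * h := by exact_mod_cast h1
      push_cast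
      linear_combination -h3
    · rintro ⟨k, hk⟩
      refine ⟨-k, ?_⟩
      push_cast at hk
      have h1 : (h : ℝ) - 2 * i - i = (h + h) * k := by exact_mod_cast hk
      have h2 : (2 * h : ℝ) ≠ 0 := by simpa using hh
      refine mul_left_cancel₀ h2 ?_
      push_cast
      linear_combination 3 * haa - Real.pi * h1
  rw [lineCoeff, chord, hk]
  by_cases hmod : (i : ℤ) ≡ (h : ℤ) - 2 * i [ZMOD (h + h : ℕ)]
  · rw [if_pos hmod, hα]
    have hc := hcos.2 hmod
    have hs : Real.sin (3 * a) ^ 2 = 1 := by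
      rw [Real.sin_sq, hc]
      ring
    have h1 : Real.sin a = Real.sin (3 * a) * Real.cos (2 * a) := by
      rw [show a = 3 * a - 2 * a by ring, Real.sin_sub, ← show a = 3 * a - 2 * a by ring, hc]
      ring
    have h2 : Real.cos a = Real.sin (3 * a) * Real.sin (2 * a) := by
      rw [show a = 3 * a - 2 * a by ring, Real.cos_sub, ← show a = 3 * a - 2 * a by ring, hc]
      ring
    refine ⟨Real.sin (3 * a), fun h0 => by simp [h0] at hs, ?_⟩
    rw [h1, h2]
    ext j
    fin_cases j
    · simp
      linear_combination -Real.cos (2 * a) * hs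
    · simp
      linear_combination -Real.sin (2 * a) * hs
    · simp
      exact (sq _).symm.trans hs |>.symm
  · rw [if_neg hmod]
    refine ⟨-2 * Real.cos (3 * a), mul_ne_zero (by norm_num) (mt hcos.1 hmod), ?_⟩
    have e2 : 2 * a = 3 * a - a := by ring
    have e4 : 4 * a = 3 * a + a := by ring
    rw [cross_apply, vertex, vertex, hα, hβ, Real.cos_pi_sub, Real.sin_pi_sub]
    ext j
    fin_cases j
    · simp
      rw [e2, e4, Real.sin_add, Real.sin_sub]
      ring
    · simp
      rw [e2, e4, Real.cos_add, Real.cos_sub]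
      ring
    · simp
      rw [e2, e4, Real.cos_add, Real.cos_sub, Real.sin_add, Real.sin_sub]
      have := Real.sin_sq_add_cos_sq a
      linear_combination (2 * Real.sin (3 * a) * Real.cos (3 * a)) * this

theorem lineCoeff_eq {n : ℕ} (hn : n ≠ 0) (heven : Even n) (i : ℕ) :
    ∃ κ : ℂ, κ ≠ 0 ∧
      (lineCoeff n i 0 : ℂ) = κ * ((root n i : ℂ) ^ 2 - root n i) ∧
      (lineCoeff n i 1 : ℂ) = κ * Complex.I * ((root n i : ℂ) ^ 2 + root n i) ∧
      (lineCoeff n i 2 : ℂ) = κ * (1 - (root n i : ℂ) ^ 3) := by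
  obtain ⟨r, hr, hl⟩ := lineCoeff_eq_smul hn heven i
  set a : ℝ := Real.pi * i / n with ha
  set w : ℂ := Complex.exp (a * Complex.I) with hw
  have hw0 : w ≠ 0 := Complex.exp_ne_zero _
  have hroot : (root n i : ℂ) = w ^ 2 := by
    rw [root, Circle.coe_exp, hw, ← Complex.exp_nat_mul, ha]
    congr 1
    push_cast
    ring
  have hI := Complex.I_sq
  have hsin : (Real.sin a : ℂ) = (w - w⁻¹) / (2 * Complex.I) := by
    rw [Complex.ofReal_sin, Complex.sin, hw, ← Complex.exp_neg]
    field_simp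
    rw [Complex.I_sq, neg_mul]
    ring
  have hcos : (Real.cos a : ℂ) = (w + w⁻¹) / 2 := by
    rw [Complex.ofReal_cos, Complex.cos, hw, ← Complex.exp_neg, neg_mul]
  have hsin3 : (Real.sin (3 * a) : ℂ) = (w ^ 3 - (w⁻¹) ^ 3) / (2 * Complex.I) := by
    rw [Complex.ofReal_sin, Complex.sin, hw, ← Complex.exp_neg, ← Complex.exp_nat_mul,
      ← Complex.exp_nat_mul]
    push_cast
    field_simp
    rw [Complex.I_sq]
    ring_nf
  refine ⟨r * (w⁻¹) ^ 3 / (2 * Complex.I), ?_, ?_, ?_, ?_⟩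
  · have : (r : ℂ) ≠ 0 := by exact_mod_cast hr
    simp [this, hw0]
  · rw [hl, hroot]
    simp only [Pi.smul_apply, Matrix.cons_val_zero, smul_eq_mul, Complex.ofReal_mul]
    rw [hsin]
    field_simp
  · rw [hl, hroot]
    simp only [Pi.smul_apply, Matrix.cons_val_one, Matrix.cons_val_zero, smul_eq_mul,
      Complex.ofReal_mul]
    rw [hcos]
    field_simp
  · rw [hl, hroot]
    simp only [Pi.smul_apply, Matrix.cons_val, smul_eq_mul, Complex.ofReal_mul,
      Complex.ofReal_neg]
    rw [hsin3]
    field_simp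
    ring

/-- With `x = ξ^i` and `U = s + t + (st)⁻¹`, the form takes the value `-κ (x³ - U x² + Ū x - 1)`,
and this cubic has roots `s`, `t`, `(st)⁻¹`. -/
theorem lineCoeff_dotProduct_sumVector_eq_zero_iff {n : ℕ} (hn : n ≠ 0) (heven : Even n) (i : ℕ)
    (s t : Circle) : lineCoeff n i ⬝ᵥ sumVector s t = 0 ↔
      root n i = s ∨ root n i = t ∨ root n i = (s * t)⁻¹ := by
  obtain ⟨κ, hκ, h0, h1, h2⟩ := lineCoeff_eq hn heven i
  have hs := Circle.coe_ne_zero s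
  have ht := Circle.coe_ne_zero t
  set x : ℂ := (root n i : ℂ)
  set U : ℂ := (s : ℂ) + t + (s * t : ℂ)⁻¹ with hU
  have hconj : (starRingEnd ℂ) U = (s : ℂ)⁻¹ + (t : ℂ)⁻¹ + s * t := by
    simp only [hU, map_add, map_inv₀, map_mul, ← Circle.coe_inv_eq_conj]
    simp [mul_comm]
  have key : ((lineCoeff n i ⬝ᵥ sumVector s t : ℝ) : ℂ) =
      -κ * ((x - s) * (x - t) * (x - (s * t : ℂ)⁻¹)) := by
    have e : ((lineCoeff n i ⬝ᵥ sumVector s t : ℝ) : ℂ) =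
        lineCoeff n i 0 * (U.re : ℂ) + lineCoeff n i 1 * (U.im : ℂ) + lineCoeff n i 2 := by
      simp [dotProduct, Fin.sum_univ_three, sumVector, hU]
    have e2 : ((lineCoeff n i ⬝ᵥ sumVector s t : ℝ) : ℂ) =
        κ * (x ^ 2 * U - x * (starRingEnd ℂ) U + (1 - x ^ 3)) := by
      rw [e, h0, h1, h2, Complex.re_eq_add_conj, Complex.im_eq_sub_conj]
      field_simp
      ring
    rw [e2, hconj, hU]
    field_simp
    ring
  rw [← Complex.ofReal_eq_zero, key, mul_eq_zero, mul_eq_zero, mul_eq_zero, neg_eq_zero, sub_eq_zero,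
    sub_eq_zero, sub_eq_zero, or_iff_right hκ, or_assoc, ← Circle.coe_inj, ← Circle.coe_inj,
    ← Circle.coe_inj]
  push_cast
  rfl

theorem lineCoeff_det_ne_zero {n : ℕ} (hn : n ≠ 0) (heven : Even n) {i j : ℕ} (hi : i < n)
    (hj : j < n) (hij : i ≠ j) :
    lineCoeff n i 0 * lineCoeff n j 1 - lineCoeff n i 1 * lineCoeff n j 0 ≠ 0 := by
  obtain ⟨κ, hκ, h0, h1, -⟩ := lineCoeff_eq hn heven i
  obtain ⟨μ, hμ, k0, k1, -⟩ := lineCoeff_eq hn heven j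
  intro h
  have h2 := congrArg (fun x : ℝ => (x : ℂ)) h
  simp only [Complex.ofReal_sub, Complex.ofReal_mul, h0, h1, k0, k1, Complex.ofReal_zero] at h2
  have hx := Circle.coe_ne_zero (root n i)
  have hy := Circle.coe_ne_zero (root n j)
  have h3 : (2 * κ * μ * Complex.I * root n i * root n j) * ((root n i : ℂ) - root n j) = 0 := by
    linear_combination h2
  rw [mul_eq_zero, or_iff_right (by simp [hκ, hμ]), sub_eq_zero, Circle.coe_inj,
    root_eq_root_iff hn hi hj] at h3
  exact hij h3

theorem mk_mem_line_iff (n i : ℕ) {v : Fin 3 → ℝ} (hv : v ≠ 0) :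
    Projectivization.mk ℝ v hv ∈ line n i ↔ lineCoeff n i ⬝ᵥ v = 0 := by
  obtain ⟨a, ha⟩ := Projectivization.exists_smul_eq_mk_rep ℝ v hv
  rw [line, Set.mem_ofPred_eq, ← ha, Units.smul_def, dotProduct_smul, smul_eq_mul, mul_eq_zero,
    or_iff_right a.ne_zero]

theorem sumVector_ne_zero (s t : Circle) : sumVector s t ≠ 0 := fun h => by
  simpa [sumVector] using congrFun h 2

/-- The point `s + t + (s t)⁻¹` of the complex plane, as a point of the real projective plane. -/
def sumPoint (s t : Circle) : ℙ ℝ (Fin 3 → ℝ) :=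
  Projectivization.mk ℝ (sumVector s t) (sumVector_ne_zero s t)

theorem sumPoint_mem_line_iff {n : ℕ} (hn : n ≠ 0) (heven : Even n) (i : ℕ) (s t : Circle) :
    sumPoint s t ∈ line n i ↔ root n i = s ∨ root n i = t ∨ root n i = (s * t)⁻¹ := by
  rw [sumPoint, mk_mem_line_iff, lineCoeff_dotProduct_sumVector_eq_zero_iff hn heven]

theorem eq_sumPoint {n : ℕ} (hn : n ≠ 0) (heven : Even n) {i j : ℕ} (hi : i < n) (hj : j < n)
    (hij : i ≠ j) {P : ℙ ℝ (Fin 3 → ℝ)} (hPi : P ∈ line n i) (hPj : P ∈ line n j) :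
    P = sumPoint (root n i) (root n j) := by
  have hdet := lineCoeff_det_ne_zero hn heven hi hj hij
  -- `w` satisfies both line equations and has last coordinate zero. The lines are not parallel, so
  -- `w = 0`.
  set w := P.rep - P.rep 2 • sumVector (root n i) (root n j) with hw
  have hi' : lineCoeff n i ⬝ᵥ w = 0 := by
    rw [hw, dotProduct_sub, dotProduct_smul,
      (lineCoeff_dotProduct_sumVector_eq_zero_iff hn heven i _ _).2 (Or.inl rfl), smul_zero,
      sub_zero]
    exact hPi
  have hj' : lineCoeff n j ⬝ᵥ w = 0 := by
    rw [hw, dotProduct_sub, dotProduct_smul,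
      (lineCoeff_dotProduct_sumVector_eq_zero_iff hn heven j _ _).2 (Or.inr (Or.inl rfl)),
      smul_zero, sub_zero]
    exact hPj
  have hw2 : w 2 = 0 := by
    rw [hw, Pi.sub_apply, Pi.smul_apply, show sumVector (root n i) (root n j) 2 = 1 from rfl,
      smul_eq_mul, mul_one, sub_self]
  simp only [dotProduct, Fin.sum_univ_three, hw2, mul_zero, add_zero] at hi' hj'
  have hw0 : w 0 = 0 := by
    refine (mul_eq_zero.1 ?_).resolve_left hdet
    linear_combination lineCoeff n j 1 * hi' - lineCoeff n i 1 * hj'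
  have hw1 : w 1 = 0 := by
    refine (mul_eq_zero.1 ?_).resolve_left hdet
    linear_combination lineCoeff n i 0 * hj' - lineCoeff n j 0 * hi'
  have hwz : w = 0 := by
    ext k
    fin_cases k
    · exact hw0
    · exact hw1
    · exact hw2
  rw [sumPoint, ← P.mk_rep, Projectivization.mk_eq_mk_iff']
  exact ⟨P.rep 2, (sub_eq_zero.1 (hw ▸ hwz)).symm⟩

theorem line_injOn {n : ℕ} (hn : n ≠ 0) (heven : Even n) :
    Set.InjOn (line n) (Finset.range n : Set ℕ) := by
  intro i hi j hj hij
  simp only [Finset.coe_range, Set.mem_Iio] at hi hj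
  by_contra hne
  have hdet := lineCoeff_det_ne_zero hn heven hi hj hne
  -- The point at infinity of the line `i` separates it from the non-parallel line `j`.
  have hv : (![lineCoeff n i 1, -lineCoeff n i 0, 0] : Fin 3 → ℝ) ≠ 0 := by
    intro h
    have h0 := congrFun h 0
    have h1 := congrFun h 1
    simp only [Matrix.cons_val_zero, Matrix.cons_val_one, Pi.zero_apply, neg_eq_zero] at h0 h1
    exact hdet (by rw [h0, h1]; ring)
  have hmem : Projectivization.mk ℝ _ hv ∈ line n i := by
    rw [mk_mem_line_iff]
    simp [dotProduct, Fin.sum_univ_three]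
    ring
  rw [hij, mk_mem_line_iff] at hmem
  simp only [dotProduct, Fin.sum_univ_three, Matrix.cons_val_zero, Matrix.cons_val_one,
    Matrix.cons_val, mul_zero, add_zero] at hmem
  exact hdet (by linear_combination -hmem)

theorem configuration_eq (n : ℕ) : configuration n = line n '' (Finset.range n : Set ℕ) := by
  ext ℓ
  simp [configuration, eq_comm]

theorem ncard_configuration {n : ℕ} (hn : n ≠ 0) (heven : Even n) :
    (configuration n).ncard = n := by
  rw [configuration_eq, (line_injOn hn heven).ncard_image, Set.ncard_coe_finset,
    Finset.card_range]

open Classical in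
/-- The indices of the lines of the configuration through a point. -/
def lineIndices (n : ℕ) (P : ℙ ℝ (Fin 3 → ℝ)) : Finset ℕ :=
  {i ∈ Finset.range n | P ∈ line n i}

theorem mem_lineIndices {n : ℕ} {P : ℙ ℝ (Fin 3 → ℝ)} {i : ℕ} :
    i ∈ lineIndices n P ↔ i < n ∧ P ∈ line n i := by
  simp [lineIndices]

theorem mem_triplePoints_iff {n : ℕ} (hn : n ≠ 0) (heven : Even n) {P : ℙ ℝ (Fin 3 → ℝ)} :
    P ∈ triplePoints n ↔ (lineIndices n P).card = 3 := by
  have : {ℓ ∈ configuration n | P ∈ ℓ} = line n '' (lineIndices n P : Set ℕ) := by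
    ext ℓ
    simp only [configuration, Set.mem_ofPred_eq, Set.mem_image, Finset.mem_coe, mem_lineIndices]
    constructor
    · rintro ⟨⟨i, hi, rfl⟩, hP⟩
      exact ⟨i, ⟨hi, hP⟩, rfl⟩
    · rintro ⟨i, ⟨hi, hP⟩, rfl⟩
      exact ⟨⟨i, hi, rfl⟩, hP⟩
  rw [triplePoints, Set.mem_ofPred_eq, this, Set.InjOn.ncard_image, Set.ncard_coe_finset]
  refine (line_injOn hn heven).mono fun i hi => ?_
  simpa using (mem_lineIndices.1 (Finset.mem_coe.1 hi)).1

theorem exists_of_mem_triplePoints {n : ℕ} (hn : n ≠ 0) (heven : Even n) {P : ℙ ℝ (Fin 3 → ℝ)}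
    (hP : P ∈ triplePoints n) : ∃ i j k : ℕ, i < n ∧ j < n ∧ i ≠ j ∧ i ≠ k ∧ j ≠ k ∧
      lineIndices n P = {i, j, k} ∧ n ∣ i + j + k ∧ P = sumPoint (root n i) (root n j) := by
  rw [mem_triplePoints_iff hn heven, Finset.card_eq_three] at hP
  obtain ⟨i, j, k, hij, hik, hjk, h⟩ := hP
  obtain ⟨hi, hPi⟩ := mem_lineIndices.1 (show i ∈ lineIndices n P by simp [h])
  obtain ⟨hj, hPj⟩ := mem_lineIndices.1 (show j ∈ lineIndices n P by simp [h])
  obtain ⟨hk, hPk⟩ := mem_lineIndices.1 (show k ∈ lineIndices n P by simp [h])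
  have hPs := eq_sumPoint hn heven hi hj hij hPi hPj
  refine ⟨i, j, k, hi, hj, hij, hik, hjk, h, ?_, hPs⟩
  rw [hPs, sumPoint_mem_line_iff hn heven, root_eq_root_iff hn hk hi, root_eq_root_iff hn hk hj,
    or_iff_right (Ne.symm hik), or_iff_right (Ne.symm hjk), eq_inv_iff_mul_eq_one, ← root_add,
    ← root_add, root_eq_one_iff hn] at hPk
  have : (n : ℤ) ∣ ((i + j + k : ℕ) : ℤ) := by
    push_cast
    rwa [add_comm] at hPk
  exact_mod_cast this

theorem finite_triplePoints {n : ℕ} (hn : n ≠ 0) (heven : Even n) : (triplePoints n).Finite := by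
  refine ((Finset.range n ×ˢ Finset.range n).finite_toSet.image
    (fun p : ℕ × ℕ => sumPoint (root n p.1) (root n p.2))).subset fun P hP => ?_
  obtain ⟨i, j, k, hi, hj, -, -, -, -, -, h⟩ := exists_of_mem_triplePoints hn heven hP
  exact ⟨(i, j), by simp [hi, hj], h.symm⟩

theorem sumPoint_mem_triplePoints {n : ℕ} (hn : n ≠ 0) (heven : Even n) {i j k : ℕ} (hi : i < n)
    (hj : j < n) (hk : k < n) (hij : i ≠ j) (hik : i ≠ k) (hjk : j ≠ k) (h : n ∣ i + j + k) :
    sumPoint (root n i) (root n j) ∈ triplePoints n ∧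
      lineIndices n (sumPoint (root n i) (root n j)) = {i, j, k} := by
  have hroot : (root n i * root n j)⁻¹ = root n k := by
    rw [inv_eq_iff_mul_eq_one, ← root_add, ← root_add, root_eq_one_iff hn]
    exact_mod_cast h
  have hL : lineIndices n (sumPoint (root n i) (root n j)) = {i, j, k} := by
    ext l
    rw [mem_lineIndices, sumPoint_mem_line_iff hn heven, hroot]
    simp only [Finset.mem_insert, Finset.mem_singleton]
    constructor
    · rintro ⟨hl, h⟩
      rwa [root_eq_root_iff hn hl hi, root_eq_root_iff hn hl hj, root_eq_root_iff hn hl hk] at h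
    · rintro (rfl | rfl | rfl) <;> simp [*]
  refine ⟨?_, hL⟩
  rw [mem_triplePoints_iff hn heven, hL]
  exact Finset.card_eq_three.2 ⟨i, j, k, hij, hik, hjk, rfl⟩

theorem sumVector_mem_coneOver_triplePoints {n : ℕ} (hn : n ≠ 0) (heven : Even n) {s t : Circle}
    (hs : s ^ n = 1) (ht : t ^ n = 1) (hst : s ≠ t) (ht' : t ≠ (s * t)⁻¹) (hs' : (s * t)⁻¹ ≠ s) :
    sumVector s t ∈ coneOver (triplePoints n) := by
  obtain ⟨k, hk, hkr⟩ := exists_root_eq hn (s := (s * t)⁻¹) (by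
    rw [inv_pow, mul_pow, hs, ht]; simp)
  obtain ⟨i, hi, rfl⟩ := exists_root_eq hn hs
  obtain ⟨j, hj, rfl⟩ := exists_root_eq hn ht
  refine ⟨sumVector_ne_zero _ _, (sumPoint_mem_triplePoints hn heven hi hj hk ?_ ?_ ?_ ?_).1⟩
  · rintro rfl; exact hst rfl
  · rintro rfl; exact hs' hkr.symm
  · rintro rfl; exact ht' hkr
  · rw [eq_comm, inv_eq_iff_mul_eq_one, ← root_add, ← root_add, root_eq_one_iff hn] at hkr
    exact_mod_cast hkr

/-! ### The product of the lines: order of vanishing and non-membership in the square -/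

theorem product_mem_vanishingToOrder {n : ℕ} (hn : n ≠ 0) (heven : Even n) :
    product n ∈ vanishingToOrder (triplePoints n) 3 := by
  simp only [vanishingToOrder, Ideal.mem_iInf]
  intro P hP
  rw [mem_triplePoints_iff hn heven] at hP
  have hsub : lineIndices n P ⊆ Finset.range n := fun i hi =>
    Finset.mem_range.2 (mem_lineIndices.1 hi).1
  rw [product, ← Finset.prod_sdiff hsub]
  refine Ideal.mul_mem_left _ _ ?_
  have hpow : idealOfPoints {P} ^ 3 = ∏ _i ∈ lineIndices n P, idealOfPoints {P} := by
    rw [Finset.prod_const, hP]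
  rw [hpow]
  refine Ideal.prod_mem_prod fun i hi => ?_
  rw [linearForm, linearForm_mem_idealOfPoints_singleton]
  exact (mem_lineIndices.1 hi).2

theorem ofMvPolynomial_linearForm {n : ℕ} (hn : n ≠ 0) (heven : Even n) (i : ℕ) :
    ∃ κ : ℂ, κ ≠ 0 ∧ ofMvPolynomial (linearForm n i) =
      κ • ((monom 1 0 - algebraMap ℂ _ (root n i)) * (monom 0 1 - algebraMap ℂ _ (root n i)) *
        (monom (-1) (-1) - algebraMap ℂ _ (root n i))) := by
  obtain ⟨κ, hκ, h0, h1, h2⟩ := lineCoeff_eq hn heven i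
  refine ⟨κ, hκ, ?_⟩
  set t : ℂ := (root n i : ℂ)
  have e1 : monom 1 0 * monom 0 1 = monom 1 1 := by rw [monom_mul]; norm_num
  have e2 : monom 1 0 * monom (-1) (-1) = monom 0 (-1) := by rw [monom_mul]; norm_num
  have e3 : monom 0 1 * monom (-1) (-1) = monom (-1) 0 := by rw [monom_mul]; norm_num
  have e4 : monom 1 1 * monom (-1) (-1) = 1 := by rw [monom_mul, ← monom_zero]; norm_num
  have hrhs : (monom 1 0 - algebraMap ℂ TorusAlgebra t) * (monom 0 1 - algebraMap ℂ _ t) *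
        (monom (-1) (-1) - algebraMap ℂ _ t) =
      t ^ 2 • elemOne - t • elemTwo + (1 - t ^ 3) • (1 : TorusAlgebra) := by
    simp only [Algebra.smul_def, elemOne, elemTwo, map_sub, map_pow, map_one]
    linear_combination (monom (-1) (-1) - algebraMap ℂ TorusAlgebra t) * e1 -
      algebraMap ℂ TorusAlgebra t * e2 - algebraMap ℂ TorusAlgebra t * e3 + e4
  have hC (r : ℝ) : ofMvPolynomial (C r) = algebraMap ℂ TorusAlgebra r := by
    rw [← algebraMap_eq, AlgHom.commutes]
    rfl
  have hX0 : ofMvPolynomial (X 0) = (1 / 2 : ℂ) • (elemOne + elemTwo) := by simp [ofMvPolynomial]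
  have hX1 : ofMvPolynomial (X 1) = (-Complex.I / 2) • (elemOne - elemTwo) := by
    simp [ofMvPolynomial]
  have hX2 : ofMvPolynomial (X 2) = 1 := by simp [ofMvPolynomial]
  rw [hrhs, linearForm, map_sum, Fin.sum_univ_three]
  have hI := Complex.I_sq
  have f1 : κ * (t ^ 2 - t) * (1 / 2) + κ * Complex.I * (t ^ 2 + t) * (-Complex.I / 2) =
      κ * t ^ 2 := by linear_combination -(κ * (t ^ 2 + t) / 2) * hI
  have f2 : κ * (t ^ 2 - t) * (1 / 2) - κ * Complex.I * (t ^ 2 + t) * (-Complex.I / 2) =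
      -(κ * t) := by linear_combination (κ * (t ^ 2 + t) / 2) * hI
  have g1 := congrArg (algebraMap ℂ TorusAlgebra) f1
  have g2 := congrArg (algebraMap ℂ TorusAlgebra) f2
  simp only [map_mul, map_add, map_sub, map_neg, map_pow] at g1 g2
  simp only [map_mul, map_add, map_sub, map_pow, map_one, hC, hX0, hX1, hX2, h0, h1, h2,
    Algebra.smul_def]
  linear_combination elemOne * g1 + elemTwo * g2

theorem ofMvPolynomial_product {n : ℕ} (hn : n ≠ 0) (heven : Even n) :
    ∃ κ : ℂ, κ ≠ 0 ∧ ofMvPolynomial (product n) =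
      κ • ((monom 1 0 ^ n - 1) * (monom 0 1 ^ n - 1) * (monom (-1) (-1) ^ n - 1)) := by
  choose κ hκ h using fun i => ofMvPolynomial_linearForm hn heven i
  refine ⟨∏ i ∈ Finset.range n, κ i, Finset.prod_ne_zero_iff.2 fun i _ => hκ i, ?_⟩
  rw [product, map_prod, Finset.prod_congr rfl fun i _ => h i]
  simp only [Algebra.smul_def, Finset.prod_mul_distrib, map_prod]
  rw [prod_sub_root hn, prod_sub_root hn, prod_sub_root hn]

theorem isHomogeneous_product (n : ℕ) : (product n).IsHomogeneous n := by
  have := IsHomogeneous.prod (Finset.range n) (linearForm n) (fun _ => 1) fun i _ => by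
    refine IsHomogeneous.sum _ _ _ fun j _ => ?_
    simpa using (isHomogeneous_C (Fin 3) (lineCoeff n i j)).mul (isHomogeneous_X ℝ j)
  simpa [product] using this

theorem _root_.MvPolynomial.homogeneousComponent_mul {σ R : Type*} [CommSemiring R] (n : ℕ)
    (f g : MvPolynomial σ R) : homogeneousComponent n (f * g) =
      ∑ p ∈ Finset.HasAntidiagonal.antidiagonal n, homogeneousComponent p.1 f * homogeneousComponent p.2 g := by
  classical
  ext d
  simp only [coeff_homogeneousComponent, coeff_sum, coeff_mul]
  have key (x : (σ →₀ ℕ) × (σ →₀ ℕ)) (hx : x ∈ Finset.HasAntidiagonal.antidiagonal d) :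
      ∑ p ∈ Finset.HasAntidiagonal.antidiagonal n,
        (if x.1.degree = p.1 then coeff x.1 f else 0) *
          (if x.2.degree = p.2 then coeff x.2 g else 0) =
      if d.degree = n then coeff x.1 f * coeff x.2 g else 0 := by
    have hdeg : x.1.degree + x.2.degree = d.degree := by
      rw [← map_add, Finset.HasAntidiagonal.mem_antidiagonal.1 hx]
    split_ifs with h
    · rw [Finset.sum_eq_single_of_mem (x.1.degree, x.2.degree)
        (Finset.HasAntidiagonal.mem_antidiagonal.2 (hdeg.trans h))]
      · simp
      rintro ⟨a, b⟩ - hab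
      simp only [ne_eq, Prod.mk.injEq, not_and_or] at hab
      rcases hab with h | h
      · rw [if_neg (Ne.symm h), zero_mul]
      · rw [if_neg (Ne.symm h), mul_zero]
    · refine Finset.sum_eq_zero fun p hp => ?_
      rw [Finset.HasAntidiagonal.mem_antidiagonal] at hp
      by_cases h1 : x.1.degree = p.1
      · rw [if_neg (show x.2.degree ≠ p.2 by omega), mul_zero]
      · rw [if_neg h1, zero_mul]
  rw [Finset.sum_comm, Finset.sum_congr rfl key]
  split_ifs <;> simp

theorem product_notMem_sq {n : ℕ} (hn : 12 ≤ n) (heven : Even n) :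
    product n ∉ idealOfPoints (triplePoints n) ^ 2 := by
  have hn0 : n ≠ 0 := by omega
  intro hmem
  obtain ⟨κ, hκ, hprod⟩ := ofMvPolynomial_product hn0 heven
  -- Elements of `I²` need not be homogeneous, so the functional is applied to the degree `n`
  -- component; for a product this splits into products of components, which again lie in `I`.
  have key : ∀ f ∈ idealOfPoints (triplePoints n) ^ 2,
      (vandermonde * vandermonde * ofMvPolynomial (homogeneousComponent n f)).coeff (n, n) =
      (vandermonde * vandermonde * ofMvPolynomial (homogeneousComponent n f)).coeff (-n, -n) := by
    intro f hf
    rw [sq] at hf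
    induction hf using Submodule.mul_induction_on' with
    | mem_mul_mem f hf g hg =>
      simp only [homogeneousComponent_mul, map_sum, Finset.mul_sum,
        AddMonoidAlgebra.coeff_sum, Finsupp.finsetSum_apply]
      refine Finset.sum_congr rfl fun p hp => ?_
      have hv (f : MvPolynomial (Fin 3) ℝ) (hf : f ∈ idealOfPoints (triplePoints n)) (d : ℕ)
          (s t : Circle) (hs : s ^ n = 1) (ht : t ^ n = 1) (hst : s ≠ t) (ht' : t ≠ (s * t)⁻¹)
          (hs' : (s * t)⁻¹ ≠ s) : eval (sumVector s t) (homogeneousComponent d f) = 0 :=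
        mem_idealOfPoints.1 (homogeneousComponent_mem_idealOfPoints hf d) _
          (sumVector_mem_coneOver_triplePoints hn0 heven hs ht hst ht' hs')
      exact coeff_vandermonde_sq_mul_eq hn (Finset.HasAntidiagonal.mem_antidiagonal.1 hp)
        (homogeneousComponent_isHomogeneous _ _) (homogeneousComponent_isHomogeneous _ _)
        (hv f hf _) (hv g hg _)
    | add f _ g _ hf hg =>
      simp only [map_add, mul_add, AddMonoidAlgebra.coeff_add, Finsupp.add_apply, hf, hg]
  have h := key _ hmem
  rw [homogeneousComponent_of_mem (isHomogeneous_product n), if_pos rfl, hprod, mul_smul_comm,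
    AddMonoidAlgebra.coeff_smul_apply, AddMonoidAlgebra.coeff_smul_apply, smul_eq_mul, smul_eq_mul,
    mul_right_inj' hκ] at h
  exact coeff_vandermonde_sq_mul_ne (by omega) h

/-! ### Counting triple points, and rationality over `ℚ(√3)` for `n = 12` -/

theorem ncard_triplePoints {n : ℕ} (hn : n ≠ 0) (heven : Even n) :
    (triplePoints n).ncard =
      ({S ∈ (Finset.range n).powersetCard 3 | n ∣ ∑ i ∈ S, i} : Finset (Finset ℕ)).card := by
  rw [← Set.ncard_coe_finset]
  refine Set.ncard_congr (fun P _ => lineIndices n P) ?_ ?_ ?_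
  · intro P hP
    obtain ⟨i, j, k, hi, hj, hij, hik, hjk, h, hdvd, -⟩ := exists_of_mem_triplePoints hn heven hP
    simp only [Finset.coe_filter, Finset.mem_powersetCard, Set.mem_ofPred_eq]
    refine ⟨⟨fun i hi => Finset.mem_range.2 (mem_lineIndices.1 hi).1,
      (mem_triplePoints_iff hn heven).1 hP⟩, ?_⟩
    rw [h, Finset.sum_insert (by simp [hij, hik]), Finset.sum_pair hjk, ← add_assoc]
    exact hdvd
  · intro P Q hP hQ hPQ
    obtain ⟨i, j, k, hi, hj, hij, -, -, h, -, hPs⟩ := exists_of_mem_triplePoints hn heven hP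
    rw [h] at hPQ
    rw [hPs]
    exact (eq_sumPoint hn heven hi hj hij
      (mem_lineIndices.1 (show i ∈ lineIndices n Q by simp [← hPQ])).2
      (mem_lineIndices.1 (show j ∈ lineIndices n Q by simp [← hPQ])).2).symm
  · intro S hS
    simp only [Finset.coe_filter, Finset.mem_powersetCard, Set.mem_ofPred_eq] at hS
    obtain ⟨⟨hsub, hcard⟩, hdvd⟩ := hS
    obtain ⟨i, j, k, hij, hik, hjk, rfl⟩ := Finset.card_eq_three.1 hcard
    rw [Finset.sum_insert (by simp [hij, hik]), Finset.sum_pair hjk, ← add_assoc] at hdvd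
    have := sumPoint_mem_triplePoints hn heven (Finset.mem_range.1 (hsub (by simp)))
      (Finset.mem_range.1 (hsub (by simp))) (Finset.mem_range.1 (hsub (by simp))) hij hik hjk hdvd
    exact ⟨_, this.1, this.2⟩

theorem ncard_triplePoints_twelve : (triplePoints 12).ncard = 19 := by
  rw [ncard_triplePoints (by norm_num) (by decide)]
  decide +kernel

theorem cos_sin_mem_qSqrtThree (m : ℤ) :
    Real.cos (2 * Real.pi * m / (12 : ℕ)) ∈ qSqrtThree ∧
      Real.sin (2 * Real.pi * m / (12 : ℕ)) ∈ qSqrtThree := by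
  have h3 : √(3 : ℝ) ∈ qSqrtThree := IntermediateField.mem_adjoin_simple_self ℚ _
  have hc : Real.cos (Real.pi / 6) ∈ qSqrtThree := by
    rw [Real.cos_pi_div_six]
    exact div_mem h3 (ofNat_mem _ 2)
  have hs : Real.sin (Real.pi / 6) ∈ qSqrtThree := by
    rw [Real.sin_pi_div_six]
    exact div_mem (one_mem _) (ofNat_mem _ 2)
  induction m using Int.induction_on with
  | zero => simp
  | succ m ih =>
    rw [show 2 * Real.pi * ((m : ℤ) + 1 : ℤ) / (12 : ℕ) =
      2 * Real.pi * (m : ℤ) / (12 : ℕ) + Real.pi / 6 by push_cast; ring, Real.cos_add, Real.sin_add]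
    exact ⟨sub_mem (mul_mem ih.1 hc) (mul_mem ih.2 hs), add_mem (mul_mem ih.2 hc) (mul_mem ih.1 hs)⟩
  | pred m ih =>
    rw [show 2 * Real.pi * (-(m : ℤ) - 1 : ℤ) / (12 : ℕ) =
      2 * Real.pi * (-(m : ℤ) : ℤ) / (12 : ℕ) - Real.pi / 6 by push_cast; ring, Real.cos_sub,
      Real.sin_sub]
    exact ⟨add_mem (mul_mem ih.1 hc) (mul_mem ih.2 hs), sub_mem (mul_mem ih.2 hc) (mul_mem ih.1 hs)⟩

theorem lineCoeff_twelve_mem_qSqrtThree (i : ℕ) (j : Fin 3) : lineCoeff 12 i j ∈ qSqrtThree := by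
  have hv (m : ℤ) (j : Fin 3) : vertex 12 m j ∈ qSqrtThree := by
    fin_cases j
    · exact (cos_sin_mem_qSqrtThree m).1
    · exact (cos_sin_mem_qSqrtThree m).2
    · exact one_mem _
  rw [lineCoeff, chord]
  split_ifs
  · fin_cases j
    · exact (cos_sin_mem_qSqrtThree _).1
    · exact (cos_sin_mem_qSqrtThree _).2
    · exact neg_mem (one_mem _)
  · rw [cross_apply]
    fin_cases j <;> exact sub_mem (mul_mem (hv _ _) (hv _ _)) (mul_mem (hv _ _) (hv _ _))

theorem sumVector_root_mem_qSqrtThree (i k : ℤ) (j : Fin 3) :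
    sumVector (root 12 i) (root 12 k) j ∈ qSqrtThree := by
  have hr (m : ℤ) : ((root 12 m : ℂ).re ∈ qSqrtThree) ∧ ((root 12 m : ℂ).im ∈ qSqrtThree) := by
    rw [root, Circle.coe_exp, Complex.exp_ofReal_mul_I_re, Complex.exp_ofReal_mul_I_im]
    exact cos_sin_mem_qSqrtThree m
  -- On the unit circle inversion is conjugation, so the coordinates are sums of cosines and sines
  -- of multiples of `π/6`, up to sign.
  have hinv : (root 12 i * root 12 k : ℂ)⁻¹ = (starRingEnd ℂ) (root 12 (i + k)) := by
    rw [← Circle.coe_inv_eq_conj, root_add]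
    push_cast
    rfl
  rw [sumVector, hinv]
  fin_cases j
  · exact add_mem (add_mem (hr i).1 (hr k).1) (hr (i + k)).1
  · exact add_mem (add_mem (hr i).2 (hr k).2) (neg_mem (hr (i + k)).2)
  · exact one_mem _

end FurediPalasti

end

theorem theorem1p3 :
    (∀ n : ℕ, Even n → 12 ≤ n →
      (FurediPalasti.configuration n).ncard = n ∧
      (FurediPalasti.triplePoints n).Finite ∧
      FurediPalasti.product n ∈ vanishingToOrder (FurediPalasti.triplePoints n) 3 ∧
      FurediPalasti.product n ∈ symbolicPower (idealOfPoints (FurediPalasti.triplePoints n)) 3 ∧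
      FurediPalasti.product n ∉ idealOfPoints (FurediPalasti.triplePoints n) ^ 2 ∧
      ¬ vanishingToOrder (FurediPalasti.triplePoints n) 3 ≤
        idealOfPoints (FurediPalasti.triplePoints n) ^ 2 ∧
      ¬ symbolicPower (idealOfPoints (FurediPalasti.triplePoints n)) 3 ≤
        idealOfPoints (FurediPalasti.triplePoints n) ^ 2) ∧
    (FurediPalasti.triplePoints 12).ncard = 19 ∧
    (∀ i < 12, ∀ j : Fin 3, FurediPalasti.lineCoeff 12 i j ∈ FurediPalasti.qSqrtThree) ∧
    (∀ P ∈ FurediPalasti.triplePoints 12, ∃ (v : Fin 3 → ℝ) (hv : v ≠ 0),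
      (∀ j : Fin 3, v j ∈ FurediPalasti.qSqrtThree) ∧ Projectivization.mk ℝ v hv = P) := by
  refine ⟨fun n heven hn => ?_, FurediPalasti.ncard_triplePoints_twelve,
    fun i _ j => FurediPalasti.lineCoeff_twelve_mem_qSqrtThree i j, fun P hP => ?_⟩
  · have hn0 : n ≠ 0 := by omega
    have hfin := FurediPalasti.finite_triplePoints hn0 heven
    have hv := FurediPalasti.product_mem_vanishingToOrder hn0 heven
    have hs := vanishingToOrder_le_symbolicPower hfin 3 hv
    have hnot := FurediPalasti.product_notMem_sq hn heven
    exact ⟨FurediPalasti.ncard_configuration hn0 heven, hfin, hv, hs, hnot,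
      fun h => hnot (h hv), fun h => hnot (h hs)⟩
  · obtain ⟨i, j, -, -, -, -, -, -, -, -, rfl⟩ :=
      FurediPalasti.exists_of_mem_triplePoints (by norm_num) (by decide) hP
    exact ⟨_, FurediPalasti.sumVector_ne_zero _ _,
      FurediPalasti.sumVector_root_mem_qSqrtThree i j, rfl⟩
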